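/- Let $\mathbb K$ be an algebraically closed field of characteristic $0$ (for example $\mathbb C$). **Conventions.** A *Jordan tuple* $J_{\lambda}(2n_1,\dots,2n_s)$ is given by integers $s\ge 1$ and $n_1\ge\dots\ge n_s\ge 1$ ($\lambda$ is a formal variable); it *has multiple maxima* if $s\ge 2$ and $n_1=n_2$. A pair $A,B$ of skew-symmetric bilinear forms on a finite-dimensional space $V$ has *algebraic type* consisting of the Jordan tuples $(2n_{t1},\dots,2n_{ts_t})$, $t=1,\dots,p$, and the Kronecker sizes $2k_1-1,\dots,2k_q-1$ ($k_j\ge1$), if there are pairwise distinct $\lambda_1,\dots,\lambda_p\in\mathbb K\cup\{\infty\}$ and a basis of $V$ in which $A$ and $B$ are simultaneously block diagonal, the pairs of blocks being one pair $\begin{pmatrix}0&N_A\\-N_A^T&0\end{pmatrix}$, $\begin{pmatrix}0&N_B\\-N_B^T&0\end{pmatrix}$ of each of the following kinds. For every $t$ and $i$, a Jordan $2n_{ti}\times 2n_{ti}$ block with eigenvalue $\lambda_t$: $N_A$ is the $n_{ti}\times n_{ti}$ upper triangular Jordan cell with eigenvalue $\lambda_t$ and $N_B$ is the identity (if $\lambda_t=\infty$,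 then $N_A$ is the identity and $N_B$ is the Jordan cell with eigenvalue $0$). For every $j$, a Kronecker $(2k_j-1)\times(2k_j-1)$ block: $N_A=(\,I\mid 0\,)$ and $N_B=(\,0\mid I\,)$ of size $(k_j-1)\times k_j$. For a finite-dimensional Lie algebra $\mathfrak g$ over $\mathbb K$ and $x\in\mathfrak g^*$ put $\mathcal A_x(\xi,\eta)=\langle x,[\xi,\eta]\rangle$. The *Jordan–Kronecker (JK) invariants* of $\mathfrak g$ are the algebraic type of the pair $\mathcal A_x,\mathcal A_a$ for all $(x,a)$ in a nonempty Zariski open subset of $\mathfrak g^*\times\mathfrak g^*$. JK invariants are *realized* by $\mathfrak g$ if they are the JK invariants of $\mathfrak g$. **Theorem.** 1. Let $m,d\ge 0$ be integers with $d\le m+1$, and let $J_{\lambda_t}(2n_{t1},\dots,2n_{ts_t})$, $t=0,\dots,d-1$, be any $d$ Jordan tuples. The JK invariants consisting of these $d$ Jordan tuples and one Kronecker $(2m+1)\times(2m+1)$ block are realized by a solvable Lie algebra over $\mathbb K$ with basis $g_1,\dots,g_m$, $h_0,\dots,h_m$, $e^i_{tj}$, $f^i_{tj}$ ($t=0,\dots,d-1$,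 $i=1,\dots,s_t$, $j=1,\dots,n_{ti}$) and commutation relations $$[g_l,h_0]=h_0,\qquad [g_l,h_l]=h_l\qquad(1\le l\le m),$$ $$[g_l,e^i_{0k}]=e^i_{0k}\quad(1\le l\le m),\qquad [g_t,e^i_{tk}]=e^i_{tk}\quad(1\le t\le d-1),$$ $$[e^i_{tj},f^i_{tk}]=\begin{cases}e^i_{t,j-k},& j>k,\\ h_t,& j=k,\end{cases}$$ where all brackets of basis vectors that do not follow from these by antisymmetry are zero. 2. Let $p,q\ge 0$. Any JK invariants with Jordan tuples $J_{\lambda_1}(2n_{11},\dots,2n_{1s_1}),\dots,J_{\lambda_p}(2n_{p1},\dots,2n_{ps_p})$ and Kronecker sizes $2k_1-1,\dots,2k_q-1$, among which at most $k_1+\dots+k_q$ Jordan tuples have multiple maxima, are realized by a finite-dimensional Lie algebra over $\mathbb K$. -/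

import Mathlib

universe u

namespace JordanKronecker

open Matrix

/-- A Jordan tuple `J_λ(2n₁, …, 2n_s)`, with the eigenvalue `λ` a formal variable: a nonempty
finite sequence `n₁ ≥ n₂ ≥ … ≥ n_s ≥ 1` of half-sizes (numbered from `0` here). -/
structure JordanTuple where
  s : ℕ
  n : Fin s → ℕ
  s_pos : 0 < s
  n_pos : ∀ i, 0 < n i
  n_anti : Antitone n

/-- The tuple has multiple maxima: `s ≥ 2` and `n₁ = n₂`. -/
def JordanTuple.HasMultipleMaxima (J : JordanTuple) : Prop :=
  ∃ h : 1 < J.s, J.n ⟨0, J.s_pos⟩ = J.n ⟨1, h⟩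

/-- A collection of Jordan tuples `J t` and Kronecker sizes `2 k j - 1` (so `k j` is the Kronecker
index), i.e. an algebraic type of a pencil. The numbering of the tuples and of the Kronecker sizes
is only a labelling of a multiset; `HasAlgebraicType` does not depend on it. -/
structure AlgebraicType where
  p : ℕ
  J : Fin p → JordanTuple
  q : ℕ
  k : Fin q → ℕ
  k_pos : ∀ j, 0 < k j

section Blocks

variable (K : Type u) [Field K]

/-- The `n × n` upper triangular Jordan cell with eigenvalue `c`. -/
def jordanCell (n : ℕ) (c : K) : Matrix (Fin n) (Fin n) K :=
  Matrix.of fun i j => if i = j then c else if (i : ℕ) + 1 = j then 1 else 0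

/-- The skew-symmetric matrix with off-diagonal blocks `N` and `-Nᵀ`. -/
def skewBlock {K : Type u} [Field K] {α β : Type} (N : Matrix α β K) :
    Matrix (α ⊕ β) (α ⊕ β) K :=
  Matrix.fromBlocks 0 N (-Nᵀ) 0

/-- First matrix of the Jordan `2n × 2n` block with eigenvalue `μ ∈ K ∪ {∞}`. -/
def jordanBlockA (n : ℕ) : OnePoint K → Matrix (Fin n ⊕ Fin n) (Fin n ⊕ Fin n) K
  | some c => skewBlock (jordanCell K n c)
  | none => skewBlock (1 : Matrix (Fin n) (Fin n) K)

/-- Second matrix of the Jordan `2n × 2n` block with eigenvalue `μ ∈ K ∪ {∞}`. -/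
def jordanBlockB (n : ℕ) : OnePoint K → Matrix (Fin n ⊕ Fin n) (Fin n ⊕ Fin n) K
  | some _ => skewBlock (1 : Matrix (Fin n) (Fin n) K)
  | none => skewBlock (jordanCell K n 0)

/-- First matrix of the Kronecker `(2k-1) × (2k-1)` block. -/
def kroneckerBlockA (k : ℕ) : Matrix (Fin (k - 1) ⊕ Fin k) (Fin (k - 1) ⊕ Fin k) K :=
  skewBlock (Matrix.of fun (i : Fin (k - 1)) (j : Fin k) => if (j : ℕ) = i then 1 else 0)

/-- Second matrix of the Kronecker `(2k-1) × (2k-1)` block. -/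
def kroneckerBlockB (k : ℕ) : Matrix (Fin (k - 1) ⊕ Fin k) (Fin (k - 1) ⊕ Fin k) K :=
  skewBlock (Matrix.of fun (i : Fin (k - 1)) (j : Fin k) => if (j : ℕ) = i + 1 then 1 else 0)

/-- Index set of a basis adapted to the blocks of the type `T`. -/
abbrev BlockIndex (T : AlgebraicType) : Type :=
  (Σ t : Fin T.p, Σ i : Fin (T.J t).s, (Fin ((T.J t).n i) ⊕ Fin ((T.J t).n i))) ⊕
    (Σ j : Fin T.q, (Fin (T.k j - 1) ⊕ Fin (T.k j)))

/-- First matrix of the Jordan-Kronecker canonical form of type `T`, where `μ t` is the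
eigenvalue of all the Jordan blocks of the tuple `t`. -/
def canonicalA (T : AlgebraicType) (μ : Fin T.p → OnePoint K) :
    Matrix (BlockIndex T) (BlockIndex T) K :=
  Matrix.fromBlocks
    (Matrix.blockDiagonal' fun t => Matrix.blockDiagonal' fun i =>
      jordanBlockA K ((T.J t).n i) (μ t))
    0 0
    (Matrix.blockDiagonal' fun j => kroneckerBlockA K (T.k j))

/-- Second matrix of the Jordan-Kronecker canonical form of type `T`. -/
def canonicalB (T : AlgebraicType) (μ : Fin T.p → OnePoint K) :
    Matrix (BlockIndex T) (BlockIndex T) K :=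
  Matrix.fromBlocks
    (Matrix.blockDiagonal' fun t => Matrix.blockDiagonal' fun i =>
      jordanBlockB K ((T.J t).n i) (μ t))
    0 0
    (Matrix.blockDiagonal' fun j => kroneckerBlockB K (T.k j))

variable {V : Type u} [AddCommGroup V] [Module K V]

/-- The pencil `A + λ B` has algebraic type `T`: in some basis of `V` the matrices of `A` and `B`
are in Jordan-Kronecker canonical form, with the Jordan blocks grouped by eigenvalue exactly as in
`T` (different tuples have different eigenvalues). -/
def HasAlgebraicType (A B : LinearMap.BilinForm K V) (T : AlgebraicType) : Prop :=
  ∃ μ : Fin T.p → OnePoint K, Function.Injective μ ∧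
    ∃ b : Module.Basis (BlockIndex T) K V,
      (∀ i j, A (b i) (b j) = canonicalA K T μ i j) ∧
      (∀ i j, B (b i) (b j) = canonicalB K T μ i j)

/-- Zariski open subsets of a (finite-dimensional) vector space: a polynomial function is a
polynomial expression in linear functionals. -/
def IsZariskiOpen (U : Set V) : Prop :=
  ∃ S : Set (MvPolynomial (Module.Dual K V) K),
    U = {v | ∃ P ∈ S, MvPolynomial.eval (fun φ : Module.Dual K V => φ v) P ≠ 0}

end Blocks

section Lie

variable (K : Type u) [Field K] (L : Type u) [LieRing L] [LieAlgebra K L]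

/-- The form `𝒜_x(ξ, η) = ⟨x, [ξ, η]⟩` on the Lie algebra `L`, for `x` in the dual space. -/
def lieForm {L : Type u} [LieRing L] [LieAlgebra K L] (x : Module.Dual K L) :
    LinearMap.BilinForm K L :=
  (LieModule.toEnd K L L : L →ₗ[K] Module.End K L).compr₂ x

theorem lieForm_apply {L : Type u} [LieRing L] [LieAlgebra K L] (x : Module.Dual K L) (ξ η : L) :
    lieForm K x ξ η = x ⁅ξ, η⁆ := rfl

/-- The Jordan-Kronecker invariants of the finite-dimensional Lie algebra `L` are those listed
in `T`: the pencil `𝒜_x + λ 𝒜_a` has algebraic type `T` for all pairs `(x, a)` in a nonempty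
Zariski open set. -/
def HasJKInvariants (T : AlgebraicType) : Prop :=
  ∃ U : Set (Module.Dual K L × Module.Dual K L), U.Nonempty ∧ IsZariskiOpen K U ∧
    ∀ z ∈ U, HasAlgebraicType K (lieForm K z.1) (lieForm K z.2) T

end Lie

/-- Labels of the basis `g₁, …, g_m`, `h₀, …, h_m`, `e^i_{tj}`, `f^i_{tj}` with
`t = 0, …, d-1`, `i = 1, …, s_t`, `j = 1, …, n_{ti}`. The labels `l` of `g`, `i` and `j` are
numbered from `0` here, so `g l` is the vector `g_{l+1}`. -/
inductive BasisLabel (m d : ℕ) (J : Fin d → JordanTuple) : Type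
  | g (l : Fin m)
  | h (r : Fin (m + 1))
  | e (t : Fin d) (i : Fin (J t).s) (j : Fin ((J t).n i))
  | f (t : Fin d) (i : Fin (J t).s) (j : Fin ((J t).n i))

open BasisLabel in
/-- The commutation relations
`[g_l, h_0] = h_0`, `[g_l, h_l] = h_l`, `[g_l, e^i_{0k}] = e^i_{0k}`, `[g_t, e^i_{tk}] = e^i_{tk}`,
`[e^i_{tj}, f^i_{tk}] = e^i_{t,j-k}` for `j > k`, `[e^i_{tj}, f^i_{tj}] = h_t`;
all other brackets of basis vectors are zero. -/
structure CommutationRelations {m d : ℕ} (hd : d ≤ m + 1) (J : Fin d → JordanTuple)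
    {L : Type u} [LieRing L] (b : BasisLabel m d J → L) : Prop where
  gg : ∀ l l', ⁅b (g l), b (g l')⁆ = 0
  gh : ∀ l r, ⁅b (g l), b (h r)⁆ = if (r : ℕ) = 0 ∨ (r : ℕ) = l + 1 then b (h r) else 0
  ge : ∀ l t i k,
    ⁅b (g l), b (e t i k)⁆ = if (t : ℕ) = 0 ∨ (t : ℕ) = l + 1 then b (e t i k) else 0
  gf : ∀ l t i k, ⁅b (g l), b (f t i k)⁆ = 0
  hh : ∀ r r', ⁅b (h r), b (h r')⁆ = 0
  he : ∀ r t i k, ⁅b (h r), b (e t i k)⁆ = 0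
  hf : ∀ r t i k, ⁅b (h r), b (f t i k)⁆ = 0
  ee : ∀ t i j t' i' k, ⁅b (e t i j), b (e t' i' k)⁆ = 0
  ff : ∀ t i j t' i' k, ⁅b (f t i j), b (f t' i' k)⁆ = 0
  ef_gt : ∀ t i (j k : Fin ((J t).n i)), k < j →
    ⁅b (e t i j), b (f t i k)⁆ =
      b (e t i ⟨(j : ℕ) - (k : ℕ) - 1, lt_of_le_of_lt (by omega) j.isLt⟩)
  ef_eq : ∀ t i (j : Fin ((J t).n i)), ⁅b (e t i j), b (f t i j)⁆ = b (h (Fin.castLE hd t))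
  ef_lt : ∀ t i (j k : Fin ((J t).n i)), j < k → ⁅b (e t i j), b (f t i k)⁆ = 0
  ef_ne : ∀ t i j t' i' k, (⟨t, i⟩ : Σ t : Fin d, Fin (J t).s) ≠ ⟨t', i'⟩ →
    ⁅b (e t i j), b (f t' i' k)⁆ = 0

end JordanKronecker

/-! The Lie algebra is a semidirect product of an abelian algebra `U`, spanned by the g and f,
acting by commuting operators on an abelian ideal `W`, spanned by the h and e. Hence `𝒜_x` only
pairs `U` with `W`, and the pencil amounts to two linear maps `u ↦ x ∘ ρ u`, `u ↦ a ∘ ρ u` from `U`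
to the dual of `W`; one needs bases of `U` and of that dual (`hasAlgebraicType_of_bases`).

Every Jordan block has a chain h, e, e, … on which the f act as shifts and the g as scalars. Encode
the values of x and a on a chain as power series X and A. An element of `U` then multiplies them by
a series q whose constant term is its weight on h (`apply_chainAct_actElem_chainVec`). Write X/A = λ
+ w with w(0) = 0, where generically w has a nonzero linear term. The identity w^k X = λ w^k A +
w^(k+1) A is a Jordan cell, ended by truncation at the length of the chain. If only positive powers
are used, a chain with ν vectors e gives size ν. If h has a g of its own, the powers start at w^0:
one cell of size ν + 1, carried by all chains over this h at once, which requires ν to be the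
largest length. Its size is then a strict maximum, so tuples with multiple maxima have to share the
h of a Kronecker block.

In a Kronecker block the g produce exactly the weights s on h_0, …, h_m with s_0 = s_1 + … + s_m.
For μ_r = a(h_r)/x(h_r), suitable β_r make β_r μ_r^i such weights for all i < m (`exists_weights`).
Extended to the chains over h_r by β_r (A/X)^i, they give elements u_i with a ∘ u_i = x ∘ u_(i+1),
the Kronecker relation.

Independence (`linearIndependent_colDual`) is a Vandermonde argument in the μ_r followed by
triangularity in the powers of w; dimensions agree by counting. Distinct h have distinct eigenvalues
x(h)/a(h), so each h of a Kronecker block can carry one tuple: k_1 + … + k_q places in all. -/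

namespace JordanKronecker

open Matrix

/-! ### Pairs of forms with two complementary isotropic subspaces; linear algebra preliminaries. -/

section Linear

variable {K : Type u} [Field K]

/-- Indices of the rows of the off-diagonal blocks in the canonical form of type `T`. -/
abbrev RowIndex (T : AlgebraicType) : Type :=
  (Σ t : Fin T.p, Σ i : Fin (T.J t).s, Fin ((T.J t).n i)) ⊕ (Σ j : Fin T.q, Fin (T.k j - 1))

/-- Indices of the columns of the off-diagonal blocks in the canonical form of type `T`. -/
abbrev ColIndex (T : AlgebraicType) : Type :=
  (Σ t : Fin T.p, Σ i : Fin (T.J t).s, Fin ((T.J t).n i)) ⊕ (Σ j : Fin T.q, Fin (T.k j))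

/-- The indices of the canonical form are the indices of rows and columns. -/
def rowColEquiv (T : AlgebraicType) : RowIndex T ⊕ ColIndex T ≃ BlockIndex T where
  toFun
    | .inl (.inl ⟨t, i, k⟩) => .inl ⟨t, i, .inl k⟩
    | .inl (.inr ⟨j, i⟩) => .inr ⟨j, .inl i⟩
    | .inr (.inl ⟨t, i, k⟩) => .inl ⟨t, i, .inr k⟩
    | .inr (.inr ⟨j, i⟩) => .inr ⟨j, .inr i⟩
  invFun
    | .inl ⟨t, i, .inl k⟩ => .inl (.inl ⟨t, i, k⟩)
    | .inr ⟨j, .inl i⟩ => .inl (.inr ⟨j, i⟩)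
    | .inl ⟨t, i, .inr k⟩ => .inr (.inl ⟨t, i, k⟩)
    | .inr ⟨j, .inr i⟩ => .inr (.inr ⟨j, i⟩)
  left_inv := by rintro ((⟨t, i, k⟩ | ⟨j, i⟩) | (⟨t, i, k⟩ | ⟨j, i⟩)) <;> rfl
  right_inv := by rintro (⟨t, i, k | k⟩ | ⟨j, i | i⟩) <;> rfl

variable {V U W : Type u} [AddCommGroup V] [Module K V] [AddCommGroup U] [Module K U]
  [AddCommGroup W] [Module K W]

open Classical in
/-- The off-diagonal part of the first matrix of the canonical form. -/
noncomputable def offDiagA (T : AlgebraicType) (c : Fin T.p → K) (x : RowIndex T)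
    (y : ColIndex T) : K :=
  match x with
  | .inl ⟨t, i, k⟩ => (if y = .inl ⟨t, i, k⟩ then c t else 0) +
      (if h : (k : ℕ) + 1 < (T.J t).n i then (if y = .inl ⟨t, i, ⟨k + 1, h⟩⟩ then 1 else 0) else 0)
  | .inr ⟨j, i⟩ => if y = .inr ⟨j, ⟨i, by omega⟩⟩ then 1 else 0

open Classical in
/-- The off-diagonal part of the second matrix of the canonical form. -/
noncomputable def offDiagB (T : AlgebraicType) (x : RowIndex T) (y : ColIndex T) : K :=
  match x with
  | .inl ⟨t, i, k⟩ => if y = .inl ⟨t, i, k⟩ then 1 else 0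
  | .inr ⟨j, i⟩ => if y = .inr ⟨j, ⟨i + 1, by omega⟩⟩ then 1 else 0

theorem jordanBlockA_coe (n : ℕ) (c : K) :
    jordanBlockA K n (c : OnePoint K) = skewBlock (jordanCell K n c) := rfl

theorem jordanBlockB_coe (n : ℕ) (c : K) :
    jordanBlockB K n (c : OnePoint K) = skewBlock 1 := rfl

theorem jordanCell_apply {n : ℕ} (c : K) (k l : Fin n) : jordanCell K n c k l =
    (if l = k then c else 0) +
      (if h : (k : ℕ) + 1 < n then (if l = ⟨k + 1, h⟩ then 1 else 0) else 0) := by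
  simp only [jordanCell, Matrix.of_apply, Fin.ext_iff]
  split_ifs <;> first | omega | simp

theorem canonicalA_rowColEquiv (T : AlgebraicType) (c : Fin T.p → K)
    (x x' : RowIndex T ⊕ ColIndex T) :
    canonicalA K T (fun t => (c t : OnePoint K)) (rowColEquiv T x) (rowColEquiv T x') =
      match x, x' with
      | .inl r, .inr y => offDiagA T c r y
      | .inr y, .inl r => - offDiagA T c r y
      | _, _ => 0 := by
  rcases x with (⟨t, i, k⟩ | ⟨j, i⟩) | (⟨t, i, k⟩ | ⟨j, i⟩) <;>
  rcases x' with (⟨t', i', k'⟩ | ⟨j', i'⟩) | (⟨t', i', k'⟩ | ⟨j', i'⟩)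
  all_goals simp only [canonicalA, rowColEquiv, Equiv.coe_fn_mk, Matrix.fromBlocks_apply₁₁,
    Matrix.fromBlocks_apply₂₂, Matrix.fromBlocks_apply₁₂, Matrix.fromBlocks_apply₂₁,
    Matrix.zero_apply]
  all_goals first
    | (simp [offDiagA]; done)
    | (rcases eq_or_ne t t' with rfl | ht
       · rcases eq_or_ne i i' with rfl | hi
         · simp [jordanBlockA_coe, skewBlock, offDiagA, jordanCell_apply, eq_comm, Fin.ext_iff]
         · simp [Matrix.blockDiagonal'_apply_ne _ _ _ hi, hi, hi.symm, offDiagA]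
       · simp [Matrix.blockDiagonal'_apply_ne _ _ _ ht, ht, ht.symm, offDiagA])
    | (rcases eq_or_ne j j' with rfl | hj
       · simp [kroneckerBlockA, skewBlock, offDiagA, Fin.ext_iff]
       · simp [Matrix.blockDiagonal'_apply_ne _ _ _ hj, hj, hj.symm, offDiagA])

theorem canonicalB_rowColEquiv (T : AlgebraicType) (c : Fin T.p → K)
    (x x' : RowIndex T ⊕ ColIndex T) :
    canonicalB K T (fun t => (c t : OnePoint K)) (rowColEquiv T x) (rowColEquiv T x') =
      match x, x' with
      | .inl r, .inr y => offDiagB T r y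
      | .inr y, .inl r => - offDiagB T r y
      | _, _ => 0 := by
  rcases x with (⟨t, i, k⟩ | ⟨j, i⟩) | (⟨t, i, k⟩ | ⟨j, i⟩) <;>
  rcases x' with (⟨t', i', k'⟩ | ⟨j', i'⟩) | (⟨t', i', k'⟩ | ⟨j', i'⟩)
  all_goals simp only [canonicalB, rowColEquiv, Equiv.coe_fn_mk, Matrix.fromBlocks_apply₁₁,
    Matrix.fromBlocks_apply₂₂, Matrix.fromBlocks_apply₁₂, Matrix.fromBlocks_apply₂₁,
    Matrix.zero_apply]
  all_goals first
    | (simp [offDiagB]; done)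
    | (rcases eq_or_ne t t' with rfl | ht
       · rcases eq_or_ne i i' with rfl | hi
         · simp [jordanBlockB_coe, skewBlock, offDiagB, Matrix.one_apply, eq_comm, Fin.ext_iff]
         · simp [Matrix.blockDiagonal'_apply_ne _ _ _ hi, hi, hi.symm, offDiagB]
       · simp [Matrix.blockDiagonal'_apply_ne _ _ _ ht, ht, ht.symm, offDiagB])
    | (rcases eq_or_ne j j' with rfl | hj
       · simp [kroneckerBlockB, skewBlock, offDiagB, Fin.ext_iff]
       · simp [Matrix.blockDiagonal'_apply_ne _ _ _ hj, hj, hj.symm, offDiagB])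

/-- Criterion for the algebraic type of a pair of forms that vanish on `U × U` and `W × W`. -/
theorem hasAlgebraicType_of_bases (T : AlgebraicType) (c : Fin T.p → K) (hc : Function.Injective c)
    (e : V ≃ₗ[K] U × W) (A B : LinearMap.BilinForm K V) (Φ Ψ : U → Module.Dual K W)
    (hA : ∀ x y, A x y = Φ (e x).1 (e y).2 - Φ (e y).1 (e x).2)
    (hB : ∀ x y, B x y = Ψ (e x).1 (e y).2 - Ψ (e y).1 (e x).2)
    (hΦ : Φ 0 = 0) (hΨ : Ψ 0 = 0)
    (bU : Module.Basis (RowIndex T) K U) (bW : Module.Basis (ColIndex T) K W)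
    (hΦb : ∀ x y, Φ (bU x) (bW y) = offDiagA T c x y)
    (hΨb : ∀ x y, Ψ (bU x) (bW y) = offDiagB T x y) :
    HasAlgebraicType K A B T := by
  refine ⟨fun t => (c t : OnePoint K), (OnePoint.coe_injective).comp hc,
    ((bU.prod bW).map e.symm).reindex (rowColEquiv T), ?_, ?_⟩
  · intro i j
    obtain ⟨x, rfl⟩ := (rowColEquiv T).surjective i
    obtain ⟨y, rfl⟩ := (rowColEquiv T).surjective j
    rw [canonicalA_rowColEquiv]
    rcases x with x | x <;> rcases y with y | y <;> simp [hA, hΦ, hΦb]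
  · intro i j
    obtain ⟨x, rfl⟩ := (rowColEquiv T).surjective i
    obtain ⟨y, rfl⟩ := (rowColEquiv T).surjective j
    rw [canonicalB_rowColEquiv]
    rcases x with x | x <;> rcases y with y | y <;> simp [hB, hΨ, hΨb]

open Classical in
/-- A basis of a space whose dual basis is a given family of functionals. -/
theorem exists_basis_of_linearIndependent_dual {ι : Type} [Fintype ι]
    [Module.Finite K W] (d : ι → Module.Dual K W) (hd : LinearIndependent K d)
    (hcard : Fintype.card ι = Module.finrank K W) :
    ∃ b : Module.Basis ι K W, ∀ i j, d i (b j) = if i = j then 1 else 0 := by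
  let bd := basisOfLinearIndependentOfCardEqFinrank' d hd
    (by rw [hcard, Subspace.dual_finrank_eq])
  refine ⟨bd.dualBasis.map (Module.evalEquiv K W).symm, fun i j => ?_⟩
  have h := bd.dualBasis_apply_self j i
  rw [Module.Basis.map_apply]
  simp only [bd, coe_basisOfLinearIndependentOfCardEqFinrank'] at h
  have h2 : (Module.evalEquiv K W) ((Module.evalEquiv K W).symm (bd.dualBasis j)) (d i)
    = bd.dualBasis j (d i) := by rw [LinearEquiv.apply_symm_apply]
  rw [Module.evalEquiv_apply] at h2
  simpa [bd, eq_comm] using h2.trans h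

/-- Nonzero weights on `k` distinct nodes that annihilate the polynomials of degree `< k - 1`, with
the sign of the first weight reversed. -/
theorem exists_weights (k : ℕ) (μ : Fin k → K) (hμ : Function.Injective μ) :
    ∃ β : Fin k → K, (∀ r, β r ≠ 0) ∧ ∀ i < k - 1, ∀ r : Fin k,
      ∑ l : Fin (k - 1), β ⟨l + 1, by omega⟩ * μ ⟨l + 1, by omega⟩ ^ i *
        (if (r : ℕ) = 0 ∨ (r : ℕ) = l + 1 then 1 else 0) = β r * μ r ^ i := by
  rcases k with _ | m
  · exact ⟨fun r => 0, fun r => r.elim0, fun i hi => by omega⟩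
  -- Barycentric weights: the sum of β r * μ r ^ i is the coefficient of degree m in the
  -- interpolation of X ^ i, hence zero for i < m.
  let β : Fin (m + 1) → K := fun r => Lagrange.nodalWeight Finset.univ μ r
  have hβ : ∀ r, β r ≠ 0 := fun r => Lagrange.nodalWeight_ne_zero hμ.injOn (Finset.mem_univ r)
  have hsum : ∀ i < m, ∑ r, β r * μ r ^ i = 0 := by
    intro i hi
    have h := Lagrange.coeff_eq_sum (s := Finset.univ) (v := μ) hμ.injOn
      (P := (Polynomial.X ^ i : Polynomial K)) (by
        rw [Polynomial.degree_X_pow]; simp; exact_mod_cast (by omega : i < m + 1))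
    simp [Polynomial.coeff_X_pow] at h
    rw [if_neg (by omega)] at h
    rw [h]
    refine Finset.sum_congr rfl fun r _ => ?_
    simp [β, Lagrange.nodalWeight, div_eq_mul_inv, mul_comm]
  -- After the sign change at node 0, the vanishing sum says that the term at 0 is the sum of all
  -- the others.
  refine ⟨fun r => if r = 0 then - β 0 else β r, fun r => ?_, fun i hi r => ?_⟩
  · dsimp only
    split_ifs
    · simpa using hβ 0
    · exact hβ r
  · have h := hsum i hi
    rw [Fin.sum_univ_succ] at h
    simp only [Nat.add_sub_cancel] at *
    change ∑ l : Fin m, (if l.succ = 0 then - β 0 else β l.succ) * μ l.succ ^ i * _ = _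
    simp only [Fin.succ_ne_zero, if_false]
    refine Fin.cases ?_ (fun r => ?_) r
    · simp; linear_combination h
    · simp only [Fin.succ_ne_zero, if_false, Fin.val_succ, Nat.add_right_cancel_iff,
        Nat.succ_ne_zero, false_or]
      rw [Finset.sum_eq_single r]
      · simp
      · intro l _ hl
        rw [if_neg (fun h => hl (Fin.ext h.symm)), mul_zero]
      · simp

/-- A homogeneous triangular system with nonzero diagonal has only the zero solution. -/
theorem eq_zero_of_triangular {n : ℕ} (M : ℕ → ℕ → K) (α : Fin n → K)
    (hM : ∀ k p, p < k → M k p = 0) (hd : ∀ k < n, M k k ≠ 0)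
    (h : ∀ p < n, ∑ k : Fin n, α k * M k p = 0) : α = 0 := by
  have hdet : (Matrix.of fun (k p : Fin n) => M k p).det ≠ 0 := by
    rw [Matrix.det_of_isUpperTriangular
      (M := Matrix.of fun (k p : Fin n) => M k p) (fun i j hij => hM i j hij)]
    exact Finset.prod_ne_zero_iff.mpr fun i _ => hd i i.isLt
  refine Matrix.eq_zero_of_vecMul_eq_zero hdet (funext fun p => ?_)
  simpa [Matrix.vecMul, dotProduct] using h p p.isLt

end Linear

end JordanKronecker

namespace JordanKronecker

/-! ### Semidirect products of abelian Lie algebras. -/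

section Semidirect

variable {K : Type u} [Field K] {U W : Type u} [AddCommGroup U] [Module K U]
  [AddCommGroup W] [Module K W]

/-- The semidirect product of the abelian Lie algebra `U` and the abelian ideal `W`, where `U` acts
on `W` by the commuting operators `ρ a`. -/
def AbelianSemidirect (ρ : U →ₗ[K] Module.End K W) (_ : ∀ a b, Commute (ρ a) (ρ b)) : Type u :=
  U × W

namespace AbelianSemidirect

variable (ρ : U →ₗ[K] Module.End K W) (hρ : ∀ a b, Commute (ρ a) (ρ b))

instance : AddCommGroup (AbelianSemidirect ρ hρ) := inferInstanceAs (AddCommGroup (U × W))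

instance : Module K (AbelianSemidirect ρ hρ) := inferInstanceAs (Module K (U × W))

/-- The underlying vector space of the semidirect product. -/
def equivProd : AbelianSemidirect ρ hρ ≃ₗ[K] U × W := LinearEquiv.refl K (U × W)

instance : LieRing (AbelianSemidirect ρ hρ) where
  bracket x y := ((0, ρ x.1 y.2 - ρ y.1 x.2) : U × W)
  add_lie x y z := Prod.ext (add_zero (0 : U)).symm (by
    change ρ (x.1 + y.1) z.2 - ρ z.1 (x.2 + y.2) =
      (ρ x.1 z.2 - ρ z.1 x.2) + (ρ y.1 z.2 - ρ z.1 y.2)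
    simp only [map_add, LinearMap.add_apply]; abel)
  lie_add x y z := Prod.ext (add_zero (0 : U)).symm (by
    change ρ x.1 (y.2 + z.2) - ρ (y.1 + z.1) x.2 =
      (ρ x.1 y.2 - ρ y.1 x.2) + (ρ x.1 z.2 - ρ z.1 x.2)
    simp only [map_add, LinearMap.add_apply]; abel)
  lie_self x := Prod.ext rfl (sub_self (ρ x.1 x.2))
  leibniz_lie x y z := Prod.ext (add_zero (0 : U)).symm (by
    change ρ x.1 (ρ y.1 z.2 - ρ z.1 y.2) - ρ 0 x.2 =
      (ρ 0 z.2 - ρ z.1 (ρ x.1 y.2 - ρ y.1 x.2)) + (ρ y.1 (ρ x.1 z.2 - ρ z.1 x.2) - ρ 0 y.2)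
    have h := fun a b m => LinearMap.congr_fun (hρ a b).eq m
    simp only [Module.End.mul_apply] at h
    simp only [map_zero, LinearMap.zero_apply, map_sub, h x.1 y.1, h x.1 z.1, h z.1 y.1]
    abel)

theorem equivProd_lie (x y : AbelianSemidirect ρ hρ) : equivProd ρ hρ ⁅x, y⁆ =
    (0, ρ (equivProd ρ hρ x).1 (equivProd ρ hρ y).2 -
      ρ (equivProd ρ hρ y).1 (equivProd ρ hρ x).2) := rfl

instance : LieAlgebra K (AbelianSemidirect ρ hρ) where
  lie_smul c x y := (equivProd ρ hρ).injective (by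
    simp only [equivProd_lie, map_smul, Prod.smul_fst, Prod.smul_snd, LinearMap.smul_apply,
      Prod.smul_mk, smul_zero, smul_sub])

/-- The abelian ideal `W` of the semidirect product. -/
def ideal : LieIdeal K (AbelianSemidirect ρ hρ) where
  carrier := {x | (equivProd ρ hρ x).1 = 0}
  add_mem' {x y} hx hy := by simp_all
  zero_mem' := by simp
  smul_mem' c x hx := by simp_all
  lie_mem {x m} _ := by
    change (equivProd ρ hρ ⁅x, m⁆).1 = 0
    simp [equivProd_lie]

/-- All brackets lie in the ideal `W`, which is abelian, so the second derived ideal vanishes. -/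
instance : LieAlgebra.IsSolvable (AbelianSemidirect ρ hρ) := by
  refine LieAlgebra.IsSolvable.mk (R := K) (k := 2) ?_
  rw [eq_bot_iff, LieAlgebra.derivedSeries_def, LieAlgebra.derivedSeriesOfIdeal_succ,
    LieAlgebra.derivedSeriesOfIdeal_succ, LieAlgebra.derivedSeriesOfIdeal_zero]
  have h1 : ⁅(⊤ : LieIdeal K (AbelianSemidirect ρ hρ)), (⊤ : LieIdeal K (AbelianSemidirect ρ hρ))⁆
      ≤ ideal ρ hρ := by
    rw [LieSubmodule.lie_le_iff]
    intro x _ y _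
    change (equivProd ρ hρ ⁅x, y⁆).1 = 0
    simp [equivProd_lie]
  refine (LieSubmodule.mono_lie h1 h1).trans ?_
  rw [LieSubmodule.lie_le_iff]
  intro x hx y hy
  have hx' : (equivProd ρ hρ x).1 = 0 := hx
  have hy' : (equivProd ρ hρ y).1 = 0 := hy
  rw [LieSubmodule.mem_bot]
  apply (equivProd ρ hρ).injective
  simp [equivProd_lie, hx', hy']

/-- The restriction of a functional to the abelian ideal. -/
def restrict (x : Module.Dual K (AbelianSemidirect ρ hρ)) : Module.Dual K W :=
  x ∘ₗ (equivProd ρ hρ).symm.toLinearMap ∘ₗ LinearMap.inr K U W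

theorem lieForm_eq (x : Module.Dual K (AbelianSemidirect ρ hρ)) (ξ η : AbelianSemidirect ρ hρ) :
    lieForm K x ξ η =
      (restrict ρ hρ x ∘ₗ ρ (equivProd ρ hρ ξ).1) (equivProd ρ hρ η).2 -
      (restrict ρ hρ x ∘ₗ ρ (equivProd ρ hρ η).1) (equivProd ρ hρ ξ).2 := by
  rw [lieForm_apply, LinearMap.comp_apply, LinearMap.comp_apply, ← map_sub]
  rfl

theorem hasAlgebraicType (T : AlgebraicType) (c : Fin T.p → K) (hc : Function.Injective c)
    (x a : Module.Dual K (AbelianSemidirect ρ hρ))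
    (bU : Module.Basis (RowIndex T) K U) (bW : Module.Basis (ColIndex T) K W)
    (hx : ∀ z y, (restrict ρ hρ x ∘ₗ ρ (bU z)) (bW y) = offDiagA T c z y)
    (ha : ∀ z y, (restrict ρ hρ a ∘ₗ ρ (bU z)) (bW y) = offDiagB T z y) :
    HasAlgebraicType K (lieForm K x) (lieForm K a) T :=
  hasAlgebraicType_of_bases T c hc (equivProd ρ hρ) _ _
    (fun u => restrict ρ hρ x ∘ₗ ρ u) (fun u => restrict ρ hρ a ∘ₗ ρ u)
    (lieForm_eq ρ hρ x) (lieForm_eq ρ hρ a) (by simp) (by simp) bU bW hx ha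

end AbelianSemidirect

end Semidirect

/-! ### Chains of vectors and the action by power series. -/

section Chains

open Sum PowerSeries

variable {K : Type u} [Field K] {G H I : Type} [DecidableEq G] [DecidableEq H]
  [DecidableEq I] (χ : G → H → K) (κ : I → H) (ν : I → ℕ)

/-- Labels of the basis of the acting algebra: the vectors `g l` and `f c k`. -/
abbrev ActLabel (G : Type) {I : Type} (ν : I → ℕ) : Type := G ⊕ Σ c : I, Fin (ν c)

/-- Labels of the basis of the abelian ideal: the vectors `h r` and `e c j`. -/
abbrev IdealLabel (H : Type) {I : Type} (ν : I → ℕ) : Type := H ⊕ Σ c : I, Fin (ν c)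

/-- The chain `h (κ c), e c 0, e c 1, …` of basis vectors, continued by zeros. -/
def chainVec (K : Type u) [Field K] {H I : Type} [DecidableEq H] [DecidableEq I] (κ : I → H)
    (ν : I → ℕ) (c : I) : ℕ → IdealLabel H ν → K
  | 0 => Pi.single (inl (κ c)) 1
  | j + 1 => if h : j < ν c then Pi.single (inr ⟨c, j, h⟩) 1 else 0

/-- The action of the basis vectors of the acting algebra on those of the abelian ideal. -/
def basisAct : ActLabel G ν → IdealLabel H ν → IdealLabel H ν → K
  | inl l, inl r => χ l r • Pi.single (inl r) 1
  | inl l, inr ⟨c, j⟩ => χ l (κ c) • Pi.single (inr ⟨c, j⟩) 1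
  | inr _, inl _ => 0
  | inr ⟨c, k⟩, inr ⟨c', j⟩ =>
      if c = c' ∧ (k : ℕ) ≤ j then - chainVec K κ ν c' (j - k) else 0

theorem chainVec_succ (c : I) (j : Fin (ν c)) :
    chainVec K κ ν c (j + 1) = Pi.single (inr ⟨c, j⟩) 1 := by
  simp [chainVec]

variable [Fintype G] [Fintype H] [Fintype I]

/-- The action of the acting algebra on the abelian ideal. -/
noncomputable def chainAct : (ActLabel G ν → K) →ₗ[K] Module.End K (IdealLabel H ν → K) :=
  (Pi.basisFun K _).constr K fun a => (Pi.basisFun K _).constr K (basisAct χ κ ν a)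

theorem chainAct_single (a : ActLabel G ν) (m : IdealLabel H ν) :
    chainAct χ κ ν (Pi.single a 1) (Pi.single m 1) = basisAct χ κ ν a m := by
  have h1 := (Pi.basisFun K (ActLabel G ν)).constr_basis K
    (fun a => (Pi.basisFun K _).constr K (basisAct χ κ ν a)) a
  have h2 := (Pi.basisFun K (IdealLabel H ν)).constr_basis K (basisAct χ κ ν a) m
  rw [Pi.basisFun_apply] at h1 h2
  rw [chainAct, h1, h2]

theorem chainAct_g_h (l : G) (r : H) :
    chainAct χ κ ν (Pi.single (inl l) 1) (Pi.single (inl r) 1) = χ l r • Pi.single (inl r) 1 :=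
  chainAct_single χ κ ν _ _

theorem chainAct_g_chainVec (l : G) (c : I) (p : ℕ) :
    chainAct χ κ ν (Pi.single (inl l) 1) (chainVec K κ ν c p) = χ l (κ c) • chainVec K κ ν c p := by
  rcases p with _ | j
  · exact chainAct_single χ κ ν _ _
  · by_cases h : j < ν c
    · simp only [chainVec, h, dif_pos]
      exact chainAct_single χ κ ν _ _
    · simp [chainVec, h]

theorem chainAct_f_h (c : I) (k : Fin (ν c)) (r : H) :
    chainAct χ κ ν (Pi.single (inr ⟨c, k⟩) 1) (Pi.single (inl r) 1) = 0 :=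
  chainAct_single χ κ ν _ _

/-- A shift by k + 1 along its own chain; the minus sign comes from reversing [e, f]. The bound `hp`
matters: beyond the end the chain is zero, but its shift need not be. -/
theorem chainAct_f_chainVec (c : I) (k : Fin (ν c)) (c' : I) (p : ℕ) (hp : p ≤ ν c') :
    chainAct χ κ ν (Pi.single (inr ⟨c, k⟩) 1) (chainVec K κ ν c' p) =
      if c = c' ∧ (k : ℕ) + 1 ≤ p then - chainVec K κ ν c' (p - (k + 1)) else 0 := by
  rcases p with _ | j
  · simpa [chainVec] using chainAct_f_h χ κ ν c k (κ c')
  · have h : chainVec K κ ν c' (j + 1) = _ := chainVec_succ κ ν c' ⟨j, hp⟩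
    rw [h, chainAct_single]
    simp [basisAct]

/-- On each chain the g are scalars and the f are shifts or zero, and such operators commute;
bilinearity does the rest. -/
theorem chainAct_commute (a b : ActLabel G ν → K) :
    Commute (chainAct χ κ ν a) (chainAct χ κ ν b) := by
  have key : ∀ (a b : ActLabel G ν),
      Commute (chainAct χ κ ν (Pi.single a 1)) (chainAct χ κ ν (Pi.single b 1)) := by
    intro a b
    refine (Pi.basisFun K _).ext fun m => ?_
    rw [Pi.basisFun_apply, Module.End.mul_apply, Module.End.mul_apply]
    rcases m with r | ⟨c, j⟩
    · rcases a with l | ⟨c, k⟩ <;> rcases b with l' | ⟨c', k'⟩ <;>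
        simp [chainAct_g_h, chainAct_f_h, smul_smul, mul_comm]
    · have hj : (j : ℕ) + 1 ≤ ν c := j.isLt
      rw [← chainVec_succ κ]
      rcases a with l | ⟨c', k⟩ <;> rcases b with l' | ⟨c'', k'⟩
      · simp [chainAct_g_chainVec, smul_smul, mul_comm]
      · rw [chainAct_f_chainVec _ _ _ _ _ _ _ hj, chainAct_g_chainVec, map_smul,
          chainAct_f_chainVec _ _ _ _ _ _ _ hj]
        split_ifs <;> simp [chainAct_g_chainVec]
      · rw [chainAct_f_chainVec _ _ _ _ _ _ _ hj, chainAct_g_chainVec, map_smul,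
          chainAct_f_chainVec _ _ _ _ _ _ _ hj]
        split_ifs <;> simp [chainAct_g_chainVec]
      · rw [chainAct_f_chainVec _ _ _ _ _ _ _ hj, chainAct_f_chainVec _ _ _ _ _ _ _ hj]
        rcases eq_or_ne c' c with rfl | h1
        · simp only [apply_ite, map_neg, map_zero]
          rw [chainAct_f_chainVec _ _ _ _ _ _ _ (by omega),
            chainAct_f_chainVec _ _ _ _ _ _ _ (by omega)]
          rcases eq_or_ne c'' c' with rfl | h2
          · simp only [true_and]
            split_ifs <;> first | (exfalso; omega) | rw [Nat.sub_right_comm] | simp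
          · simp [h2]
        · simp only [h1, false_and, if_false, map_zero]
          split_ifs
          · rw [map_neg, chainAct_f_chainVec _ _ _ _ _ _ _ (by omega)]
            simp [h1]
          · simp
  have ha : a ∈ Submodule.span K (Set.range (Pi.basisFun K (ActLabel G ν))) := by
    rw [(Pi.basisFun K (ActLabel G ν)).span_eq]; trivial
  have hb : b ∈ Submodule.span K (Set.range (Pi.basisFun K (ActLabel G ν))) := by
    rw [(Pi.basisFun K (ActLabel G ν)).span_eq]; trivial
  induction ha using Submodule.span_induction with
  | mem x hx =>
    obtain ⟨i, rfl⟩ := hx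
    induction hb using Submodule.span_induction with
    | mem y hy => obtain ⟨j, rfl⟩ := hy; simpa using key i j
    | zero => simp
    | add y z _ _ hy hz => rw [map_add]; exact hy.add_right hz
    | smul s y _ hy => rw [map_smul]; exact hy.smul_right s
  | zero => simp
  | add y z _ _ hy hz => rw [map_add]; exact hy.add_left hz
  | smul s y _ hy => rw [map_smul]; exact hy.smul_left s

/-- The element of the acting algebra with coordinates `γ l` at `g l` that acts on the chain `c` as
the power series `q c` in the shift. -/
noncomputable def actElem (γ : G → K) (q : I → K⟦X⟧) : ActLabel G ν → K
  | inl l => γ l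
  | inr ⟨c, k⟩ => - coeff (k + 1) (q c)

/-- The values of a functional on the chain `c`, as the coefficients of a power series. -/
noncomputable def chainSeries (x : Module.Dual K (IdealLabel H ν → K)) (c : I) : K⟦X⟧ :=
  mk fun p => x (chainVec K κ ν c p)

theorem chainAct_apply (a : ActLabel G ν → K) (m : IdealLabel H ν → K) :
    chainAct χ κ ν a m = (∑ l, a (inl l) • chainAct χ κ ν (Pi.single (inl l) 1) m) +
      ∑ c, ∑ k : Fin (ν c), a (inr ⟨c, k⟩) • chainAct χ κ ν (Pi.single (inr ⟨c, k⟩) 1) m := by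
  conv_lhs => rw [pi_eq_sum_univ' a]
  simp [map_sum, Fintype.sum_sigma, LinearMap.sum_apply]

theorem chainAct_actElem_h (γ : G → K) (q : I → K⟦X⟧) (r : H) :
    chainAct χ κ ν (actElem ν γ q) (Pi.single (inl r) 1) =
      (∑ l, γ l * χ l r) • Pi.single (inl r) 1 := by
  rw [chainAct_apply]
  simp [chainAct_g_h, chainAct_f_h, actElem, smul_smul, Finset.sum_smul]

/-- A Cauchy product: the g supply the constant term of `q c`, and `f c k` supplies degree k + 1,
the signs in `basisAct` and `actElem` cancelling. -/
theorem apply_chainAct_actElem_chainVec (x : Module.Dual K (IdealLabel H ν → K)) (γ : G → K)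
    (q : I → K⟦X⟧) (c : I) (hq : coeff 0 (q c) = ∑ l, γ l * χ l (κ c)) (p : ℕ) (hp : p ≤ ν c) :
    x (chainAct χ κ ν (actElem ν γ q) (chainVec K κ ν c p)) =
      coeff p (q c * chainSeries κ ν x c) := by
  rw [chainAct_apply, coeff_mul, Finset.Nat.sum_antidiagonal_eq_sum_range_succ
    (fun i j => coeff i (q c) * coeff j (chainSeries κ ν x c)), Finset.sum_range_succ', add_comm,
    map_add]
  congr 1
  · rw [Finset.sum_eq_single c]
    · have h : ∀ k : Fin (ν c), actElem ν γ q (inr ⟨c, k⟩) •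
          chainAct χ κ ν (Pi.single (inr ⟨c, k⟩) 1) (chainVec K κ ν c p) =
          (fun k : ℕ => if k < p then coeff (k + 1) (q c) • chainVec K κ ν c (p - (k + 1))
            else 0) k := by
        intro k
        rw [chainAct_f_chainVec _ _ _ _ _ _ _ hp]
        simp [actElem]
      rw [Finset.sum_congr rfl fun k _ => h k, Fin.sum_univ_eq_sum_range
        (fun k : ℕ => if k < p then coeff (k + 1) (q c) • chainVec K κ ν c (p - (k + 1)) else 0),
        map_sum]
      rw [← Finset.sum_subset (Finset.range_subset_range.mpr hp)]
      · refine Finset.sum_congr rfl fun k hk => ?_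
        simp [Finset.mem_range.mp hk, chainSeries]
      · intro k _ hk
        simp [Finset.mem_range] at hk
        simp [Nat.not_lt.mpr hk]
    · intro c' _ hc
      refine Finset.sum_eq_zero fun k _ => ?_
      rw [chainAct_f_chainVec _ _ _ _ _ _ _ hp]
      simp [hc]
    · simp
  · simp [chainAct_g_chainVec, actElem, chainSeries, hq, Finset.sum_mul, mul_assoc]

end Chains

end JordanKronecker

namespace JordanKronecker

/-! ### The nilpotent part of a quotient of series. -/

section Series

open PowerSeries

variable {K : Type u} [Field K]

/-- The nilpotent part of the quotient `P / Q` of two power series. -/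
noncomputable def nilQuot (P Q : K⟦X⟧) : K⟦X⟧ :=
  P * Q⁻¹ - C (coeff 0 P / coeff 0 Q)

theorem coeff_zero_nilQuot (P Q : K⟦X⟧) : coeff 0 (nilQuot P Q) = 0 := by
  simp [nilQuot, div_eq_mul_inv]

theorem nilQuot_mul (P Q : K⟦X⟧) (hQ : coeff 0 Q ≠ 0) :
    nilQuot P Q * Q = P - C (coeff 0 P / coeff 0 Q) * Q := by
  rw [nilQuot, sub_mul, mul_assoc, PowerSeries.inv_mul_cancel _ (by simpa using hQ), mul_one]

/-- Comparing degree one in `nilQuot_mul` shows that this coefficient times `coeff 0 Q` squared is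
the 2 × 2 minor in `h`. -/
theorem coeff_one_nilQuot (P Q : K⟦X⟧) (hQ : coeff 0 Q ≠ 0)
    (h : coeff 1 P * coeff 0 Q ≠ coeff 0 P * coeff 1 Q) : coeff 1 (nilQuot P Q) ≠ 0 := by
  intro h0
  have h1 := congrArg (coeff 1) (nilQuot_mul P Q hQ)
  rw [coeff_mul, Finset.Nat.sum_antidiagonal_eq_sum_range_succ
    (fun i j => coeff i (nilQuot P Q) * coeff j Q), Finset.sum_range_succ, Finset.sum_range_one,
    coeff_zero_nilQuot, h0, map_sub, coeff_C_mul] at h1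
  apply h
  field_simp at h1
  linear_combination -h1

theorem X_pow_dvd_pow {w : K⟦X⟧} (hw : coeff 0 w = 0) (k : ℕ) : X ^ k ∣ w ^ k :=
  pow_dvd_pow_of_dvd (X_dvd_iff.mpr (by simpa using hw)) k

theorem coeff_pow_mul_of_lt {w : K⟦X⟧} (hw : coeff 0 w = 0) (Q : K⟦X⟧) {k p : ℕ} (h : p < k) :
    coeff p (w ^ k * Q) = 0 :=
  X_pow_dvd_iff.mp ((X_pow_dvd_pow hw k).mul_right Q) p h

/-- Provides the diagonal of the triangular systems in the independence proof. -/
theorem coeff_pow_mul_self {w : K⟦X⟧} (hw : coeff 0 w = 0) (Q : K⟦X⟧) (k : ℕ) :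
    coeff k (w ^ k * Q) = coeff 1 w ^ k * coeff 0 Q := by
  obtain ⟨v, rfl⟩ := X_dvd_iff.mpr (by simpa using hw : constantCoeff w = 0)
  have h1 : coeff 1 (X * v) = coeff 0 v := coeff_succ_X_mul 0 v
  have h2 := coeff_X_pow_mul (v ^ k * Q) k 0
  rw [h1, mul_pow, mul_assoc]
  rw [zero_add] at h2
  rw [h2]
  simp

end Series

/-! ### Combinatorial data, and the Jordan and Kronecker families. -/

section Realization

open Sum PowerSeries

/-- The combinatorial data of the realization of the type `T`: `F` is the set of tuples that are
realized without a Kronecker block, the other tuples are attached to distinct positions in the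
Kronecker blocks. -/
structure Realization (T : AlgebraicType) where
  F : Finset (Fin T.p)
  κ : Fin T.p → F ⊕ (Σ j : Fin T.q, Fin (T.k j))
  κ_injective : Function.Injective κ
  κ_of_mem : ∀ t : F, κ t = inl t
  ν : (Σ t : Fin T.p, Fin (T.J t).s) → ℕ
  -- For a tuple in `F`, block 0 gains one dimension from the private g and h, so its chain is one
  -- shorter.
  ν_add : ∀ t i, ν ⟨t, i⟩ + (if t ∈ F ∧ (i : ℕ) = 0 then 1 else 0) = (T.J t).n i
  -- Block 0 lives on all chains of its tuple; this bound makes its cell end on each of them.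
  ν_le : ∀ t ∈ F, ∀ i, ν ⟨t, i⟩ ≤ ν ⟨t, ⟨0, (T.J t).s_pos⟩⟩

namespace Realization

variable {T : AlgebraicType} (R : Realization T)

/-- Labels of the vectors `g`. -/
abbrev G : Type := R.F ⊕ (Σ j : Fin T.q, Fin (T.k j - 1))

/-- Labels of the vectors `h`. -/
abbrev H : Type := R.F ⊕ (Σ j : Fin T.q, Fin (T.k j))

/-- Labels of the chains. -/
abbrev I (_ : Realization T) : Type := Σ t : Fin T.p, Fin (T.J t).s

/-- The vector `h` at the end of the chain. -/
abbrev base (c : R.I) : R.H := R.κ c.1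

variable (K : Type u) [Field K]

/-- The weights of the vectors `g` on the vectors `h`. -/
def weight : R.G → R.H → K
  | inl t, inl t' => if t = t' then 1 else 0
  | inr ⟨j, l⟩, inr ⟨j', r⟩ => if j = j' ∧ ((r : ℕ) = 0 ∨ (r : ℕ) = l + 1) then 1 else 0
  | _, _ => 0

/-- The space of the acting algebra. -/
abbrev Act : Type u := ActLabel R.G R.ν → K

/-- The space of the abelian ideal. -/
abbrev Ide : Type u := IdealLabel R.H R.ν → K

variable {K}

/-- The vector `h r`. -/
abbrev hVec (K : Type u) [Field K] (r : R.H) : R.Ide K := Pi.single (inl r) 1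

/-- The action of the acting algebra on the abelian ideal. -/
noncomputable abbrev act : R.Act K →ₗ[K] Module.End K (R.Ide K) := chainAct (R.weight K) R.base R.ν

/-- Genericity of a pair of functionals on the abelian ideal. -/
structure Generic (x a : Module.Dual K (R.Ide K)) : Prop where
  x_ne : ∀ r, x (R.hVec K r) ≠ 0
  a_ne : ∀ r, a (R.hVec K r) ≠ 0
  ne : ∀ r r', r ≠ r' → x (R.hVec K r) * a (R.hVec K r') ≠ x (R.hVec K r') * a (R.hVec K r)
  e_ne : ∀ c, ∀ h : 0 < R.ν c, x (Pi.single (inr ⟨c, 0, h⟩) 1) * a (R.hVec K (R.base c)) ≠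
    x (R.hVec K (R.base c)) * a (Pi.single (inr ⟨c, 0, h⟩) 1)

/-- The functional with given values on the vectors `h` and given series on the chains. -/
noncomputable def func (s : R.H → K) (Q : R.I → K⟦X⟧) : Module.Dual K (R.Ide K) :=
  (Pi.basisFun K _).constr K fun
    | inl r => s r
    | inr ⟨c, j⟩ => coeff (j + 1) (Q c)

theorem func_h (s : R.H → K) (Q : R.I → K⟦X⟧) (r : R.H) : R.func s Q (R.hVec K r) = s r := by
  have h := (Pi.basisFun K (IdealLabel R.H R.ν)).constr_basis K
    (fun | inl r => s r | inr ⟨c, j⟩ => coeff (j + 1) (Q c)) (inl r)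
  rwa [Pi.basisFun_apply] at h

theorem func_e (s : R.H → K) (Q : R.I → K⟦X⟧) (c : R.I) (j : Fin (R.ν c)) :
    R.func s Q (Pi.single (inr ⟨c, j⟩) 1) = coeff (j + 1) (Q c) := by
  have h := (Pi.basisFun K (IdealLabel R.H R.ν)).constr_basis K
    (fun | inl r => s r | inr ⟨c, j⟩ => coeff (j + 1) (Q c)) (inr ⟨c, j⟩)
  rwa [Pi.basisFun_apply] at h

theorem dual_ext {f g : Module.Dual K (R.Ide K)} (h : ∀ r, f (R.hVec K r) = g (R.hVec K r))
    (h' : ∀ c j, f (Pi.single (inr ⟨c, j⟩) 1) = g (Pi.single (inr ⟨c, j⟩) 1)) : f = g := by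
  refine (Pi.basisFun K _).ext fun m => ?_
  rw [Pi.basisFun_apply]
  rcases m with r | ⟨c, j⟩
  · exact h r
  · exact h' c j

/-- Reduces identities between functionals on the ideal to identities of weights and of power
series. -/
theorem apply_act_actElem (x : Module.Dual K (R.Ide K)) (γ : R.G → K) (q : R.I → K⟦X⟧)
    (s : R.H → K) (hs : ∀ r, ∑ l, γ l * R.weight K l r = s r)
    (hq : ∀ c, coeff 0 (q c) = s (R.base c)) :
    x ∘ₗ R.act (actElem R.ν γ q) = R.func (fun r => s r * x (R.hVec K r))
      (fun c => q c * chainSeries R.base R.ν x c) := by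
  refine R.dual_ext (fun r => ?_) fun c j => ?_
  · rw [func_h, LinearMap.comp_apply, chainAct_actElem_h, map_smul, hs, smul_eq_mul]
  · rw [func_e, LinearMap.comp_apply, ← chainVec_succ R.base,
      apply_chainAct_actElem_chainVec _ _ _ _ _ _ _ (by rw [hq, hs]) _ j.isLt]

section Families

variable (x a : Module.Dual K (R.Ide K))

/-- The eigenvalue that belongs to `h r`. -/
noncomputable def eigen (r : R.H) : K := x (R.hVec K r) / a (R.hVec K r)

/-- The nilpotent part of the quotient of the series of `x` and `a` on a chain. -/
noncomputable def nil (c : R.I) : K⟦X⟧ :=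
  nilQuot (chainSeries R.base R.ν x c) (chainSeries R.base R.ν a c)

/-- The quotient of the series of `a` and `x` on a chain. -/
noncomputable def quot (c : R.I) : K⟦X⟧ :=
  chainSeries R.base R.ν a c * (chainSeries R.base R.ν x c)⁻¹

theorem coeff_zero_chainSeries (c : R.I) :
    coeff 0 (chainSeries R.base R.ν x c) = x (R.hVec K (R.base c)) := by
  simp [chainSeries, chainVec]

theorem nil_mul (ha : ∀ r, a (R.hVec K r) ≠ 0) (c : R.I) :
    R.nil x a c * chainSeries R.base R.ν a c =
      chainSeries R.base R.ν x c - C (R.eigen x a (R.base c)) * chainSeries R.base R.ν a c := by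
  rw [nil, nilQuot_mul _ _ (by rw [coeff_zero_chainSeries]; exact ha _), coeff_zero_chainSeries,
    coeff_zero_chainSeries]
  rfl

theorem quot_mul (hx : ∀ r, x (R.hVec K r) ≠ 0) (c : R.I) :
    R.quot x a c * chainSeries R.base R.ν x c = chainSeries R.base R.ν a c := by
  rw [quot, mul_assoc, PowerSeries.inv_mul_cancel, mul_one]
  rw [← coeff_zero_eq_constantCoeff_apply, coeff_zero_chainSeries]
  exact hx _

theorem coeff_zero_quot (c : R.I) :
    coeff 0 (R.quot x a c) = a (R.hVec K (R.base c)) / x (R.hVec K (R.base c)) := by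
  have h1 := R.coeff_zero_chainSeries x c
  have h2 := R.coeff_zero_chainSeries a c
  simp only [coeff_zero_eq_constantCoeff] at h1 h2
  simp [quot, h1, h2, div_eq_mul_inv]

theorem coeff_one_nil (h : R.Generic x a) (c : R.I) (hc : 0 < R.ν c) :
    coeff 1 (R.nil x a c) ≠ 0 := by
  have key : ∀ y : Module.Dual K (R.Ide K), coeff 1 (chainSeries R.base R.ν y c) =
      y (Pi.single (inr ⟨c, 0, hc⟩) 1) := fun y => by simp [chainSeries, chainVec, hc]
  refine coeff_one_nilQuot _ _ ?_ ?_
  · rw [coeff_zero_chainSeries]; exact h.a_ne _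
  · rw [coeff_zero_chainSeries, coeff_zero_chainSeries, key, key]; exact h.e_ne c hc

/-- The coordinates at the vectors `g` in the Jordan families. -/
def jordanG (t : Fin T.p) (i k : ℕ) : R.G → K
  | inl t' => if (t' : Fin T.p) = t ∧ i = 0 ∧ k = 0 then 1 else 0
  | inr _ => 0

/-- The weights of the Jordan families on the vectors `h`. -/
def jordanH (t : Fin T.p) (i k : ℕ) (r : R.H) : K :=
  if t ∈ R.F ∧ i = 0 ∧ k = 0 ∧ r = R.κ t then 1 else 0

/-- The series of the Jordan families. -/
noncomputable def jordanSeries (t : Fin T.p) (i : Fin (T.J t).s) (k : ℕ) (c : R.I) : K⟦X⟧ :=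
  if t ∈ R.F ∧ (i : ℕ) = 0 then (if c.1 = t then R.nil x a c ^ k else 0)
  else (if c = ⟨t, i⟩ then R.nil x a c ^ (k + 1) else 0)

/-- Only the member k = 0 of block 0 of a tuple in `F` has a constant term; the private g of that
tuple produces it. -/
theorem sum_jordanG (t : Fin T.p) (i k : ℕ) (r : R.H) :
    ∑ l, R.jordanG t i k l * R.weight K l r = R.jordanH t i k r := by
  rw [Fintype.sum_sum_type]
  simp only [jordanG, zero_mul, Finset.sum_const_zero, add_zero]
  rcases r with t' | r
  · by_cases h : t ∈ R.F
    · have hκ := R.κ_of_mem ⟨t, h⟩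
      simp only at hκ
      rw [Finset.sum_eq_single t']
      · simp [weight, jordanH, h, hκ, Subtype.ext_iff, and_comm, and_left_comm]
      · intro b _ hb
        simp [weight, hb]
      · simp
    · simp only [jordanH, h, false_and, if_false]
      refine Finset.sum_eq_zero fun b _ => ?_
      rw [if_neg (fun hb : (b : Fin T.p) = t ∧ _ => h (hb.1 ▸ b.2)), zero_mul]
  · simp only [weight, mul_zero, Finset.sum_const_zero, jordanH]
    rw [if_neg]
    rintro ⟨h, -, -, hr⟩
    have hκ := R.κ_of_mem ⟨t, h⟩
    simp only at hκ
    rw [hκ] at hr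
    cases hr

theorem coeff_zero_jordanSeries (t : Fin T.p) (i : Fin (T.J t).s) (k : ℕ) (c : R.I) :
    coeff 0 (R.jordanSeries x a t i k c) = R.jordanH t i k (R.base c) := by
  have h0 : constantCoeff (R.nil x a c) = 0 := by
    rw [← coeff_zero_eq_constantCoeff_apply]; exact coeff_zero_nilQuot _ _
  by_cases h : t ∈ R.F ∧ (i : ℕ) = 0
  · by_cases hc : c.1 = t <;> by_cases hk : k = 0 <;>
      simp [jordanSeries, jordanH, h, hc, hk, h0, R.κ_injective.eq_iff]
  · have h' : ¬ (t ∈ R.F ∧ (i : ℕ) = 0 ∧ k = 0 ∧ R.base c = R.κ t) := fun h1 => h ⟨h1.1, h1.2.1⟩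
    rw [jordanSeries, jordanH, if_neg h, if_neg h']
    split_ifs <;> simp [h0]

/-- The relation X = (λ + w) A multiplied by a power of w. -/
theorem jordanSeries_mul (ha : ∀ r, a (R.hVec K r) ≠ 0) (t : Fin T.p) (i : Fin (T.J t).s) (k : ℕ)
    (c : R.I) : R.jordanSeries x a t i k c * chainSeries R.base R.ν x c =
      C (R.eigen x a (R.κ t)) * (R.jordanSeries x a t i k c * chainSeries R.base R.ν a c) +
        R.jordanSeries x a t i (k + 1) c * chainSeries R.base R.ν a c := by
  have h := R.nil_mul x a ha c
  simp only [jordanSeries]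
  split_ifs with h1 h2 h2
  · subst h2
    rw [pow_succ]
    linear_combination (-R.nil x a c ^ k) * h
  · simp
  · subst h2
    rw [pow_succ _ (k + 1)]
    linear_combination (-R.nil x a ⟨t, i⟩ ^ (k + 1)) * h
  · simp

theorem jordanH_mul (ha : ∀ r, a (R.hVec K r) ≠ 0) (t : Fin T.p) (i k : ℕ) (r : R.H) :
    R.jordanH t i k r * x (R.hVec K r) =
      R.eigen x a (R.κ t) * (R.jordanH t i k r * a (R.hVec K r)) +
        R.jordanH t i (k + 1) r * a (R.hVec K r) := by
  simp only [jordanH, Nat.add_eq_zero_iff, one_ne_zero, and_false, false_and, if_false, zero_mul,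
    add_zero]
  split_ifs with h
  · rw [h.2.2.2, eigen, one_mul, one_mul, div_mul_cancel₀ _ (ha _)]
  · simp

/-- The end of the Jordan cell. The exponent of the nilpotent part is now at least ν c + 1 on each
chain involved: by `ν_add` on the block's own chain, and by `ν_le` on the other chains of a tuple in
`F`. -/
theorem jordanSeries_mul_eq_zero (t : Fin T.p) (i : Fin (T.J t).s) (c : R.I) (Q : K⟦X⟧) (p : ℕ)
    (hp : p ≤ R.ν c) : coeff p (R.jordanSeries x a t i ((T.J t).n i) c * Q) = 0 := by
  have hν := R.ν_add t i
  have h0 : coeff 0 (R.nil x a c) = 0 := coeff_zero_nilQuot _ _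
  simp only [jordanSeries]
  split_ifs with h1 h2 h2
  · obtain ⟨t', i'⟩ := c
    obtain rfl : t' = t := h2
    have := R.ν_le t' h1.1 i'
    have hi : i = ⟨0, (T.J t').s_pos⟩ := Fin.ext h1.2
    rw [if_pos h1, hi] at hν
    exact coeff_pow_mul_of_lt h0 _ (by rw [hi]; omega)
  · simp
  · subst h2
    rw [if_neg h1] at hν
    exact coeff_pow_mul_of_lt h0 _ (by omega)
  · simp

variable (β : ∀ j : Fin T.q, Fin (T.k j) → K)

/-- The weights of the Kronecker families before powers are taken. -/
def kronWeight (j : Fin T.q) : R.H → K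
  | inl _ => 0
  | inr ⟨j', r⟩ => if j' = j then β j' r else 0

/-- The weights of the Kronecker families on the vectors `h`. -/
noncomputable def kronH (j : Fin T.q) (i : ℕ) (r : R.H) : K :=
  R.kronWeight β j r * (a (R.hVec K r) / x (R.hVec K r)) ^ i

/-- The coordinates at the vectors `g` in the Kronecker families. -/
noncomputable def kronG (j : Fin T.q) (i : ℕ) : R.G → K
  | inl _ => 0
  | inr ⟨j', l⟩ => R.kronH x a β j i (inr ⟨j', ⟨l + 1, by omega⟩⟩)

/-- The series of the Kronecker families. -/
noncomputable def kronSeries (j : Fin T.q) (i : ℕ) (c : R.I) : K⟦X⟧ :=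
  C (R.kronWeight β j (R.base c)) * R.quot x a c ^ i

theorem coeff_zero_kronSeries (j : Fin T.q) (i : ℕ) (c : R.I) :
    coeff 0 (R.kronSeries x a β j i c) = R.kronH x a β j i (R.base c) := by
  have h := R.coeff_zero_quot x a c
  simp only [coeff_zero_eq_constantCoeff] at h
  simp [kronSeries, kronH, h]

theorem kronSeries_mul (hx : ∀ r, x (R.hVec K r) ≠ 0) (j : Fin T.q) (i : ℕ) (c : R.I) :
    R.kronSeries x a β j i c * chainSeries R.base R.ν a c =
      R.kronSeries x a β j (i + 1) c * chainSeries R.base R.ν x c := by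
  rw [← R.quot_mul x a hx, kronSeries, kronSeries, pow_succ]
  ring

theorem kronH_mul (hx : ∀ r, x (R.hVec K r) ≠ 0) (j : Fin T.q) (i : ℕ) (r : R.H) :
    R.kronH x a β j i r * a (R.hVec K r) = R.kronH x a β j (i + 1) r * x (R.hVec K r) := by
  have := hx r
  rw [kronH, kronH, pow_succ]
  field_simp

/-- The vector g l has weight one at the positions 0 and l + 1, so the coordinates are read off at l
+ 1 and the only real condition is `hβ` at position 0. -/
theorem sum_kronG (j : Fin T.q) (i : ℕ)
    (hβ : ∀ r : Fin (T.k j), ∑ l : Fin (T.k j - 1), β j ⟨l + 1, by omega⟩ *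
      (a (R.hVec K (inr ⟨j, ⟨l + 1, by omega⟩⟩)) / x (R.hVec K (inr ⟨j, ⟨l + 1, by omega⟩⟩))) ^ i *
        (if (r : ℕ) = 0 ∨ (r : ℕ) = l + 1 then 1 else 0) =
      β j r * (a (R.hVec K (inr ⟨j, r⟩)) / x (R.hVec K (inr ⟨j, r⟩))) ^ i) (r : R.H) :
    ∑ l, R.kronG x a β j i l * R.weight K l r = R.kronH x a β j i r := by
  rw [Fintype.sum_sum_type]
  simp only [kronG, zero_mul, Finset.sum_const_zero, zero_add]
  rcases r with t' | ⟨j', r⟩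
  · simp [weight, kronH, kronWeight]
  · rw [Fintype.sum_sigma, Finset.sum_eq_single j']
    · rcases eq_or_ne j' j with rfl | hj
      · simpa [weight, kronH, kronWeight] using hβ r
      · simp [kronH, kronWeight, hj]
    · intro j'' _ hj
      simp [weight, hj]
    · simp

end Families

end Realization

end Realization

end JordanKronecker

namespace JordanKronecker

open Sum PowerSeries

/-! ### Canonical bases for a generic pair of functionals. -/

namespace Realization

variable {T : AlgebraicType} (R : Realization T)

theorem sum_ν : (∑ c, R.ν c) + R.F.card = ∑ t, ∑ i, (T.J t).n i := by
  have h : ∀ t, ∑ i : Fin (T.J t).s, (if t ∈ R.F ∧ (i : ℕ) = 0 then 1 else 0) =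
      if t ∈ R.F then 1 else 0 := by
    intro t
    rw [Finset.sum_eq_single ⟨0, (T.J t).s_pos⟩]
    · simp
    · intro i _ hi
      rw [if_neg]
      rintro ⟨-, h⟩
      exact hi (Fin.ext h)
    · simp
  simp only [← R.ν_add, Finset.sum_add_distrib, h, Fintype.sum_sigma]
  simp

/-- Each tuple in `F` has one f fewer than its Jordan rows, compensated by its private g. -/
theorem card_rowIndex : Fintype.card (RowIndex T) = Fintype.card (ActLabel R.G R.ν) := by
  have h := R.sum_ν
  simp only [Fintype.card_sum, Fintype.card_sigma, Fintype.card_fin, Fintype.card_coe] at *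
  omega

theorem card_colIndex : Fintype.card (ColIndex T) = Fintype.card (IdealLabel R.H R.ν) := by
  have h := R.sum_ν
  simp only [Fintype.card_sum, Fintype.card_sigma, Fintype.card_fin, Fintype.card_coe] at *
  omega

variable {K : Type u} [Field K] (x a : Module.Dual K (R.Ide K)) (β : ∀ j : Fin T.q, Fin (T.k j) → K)

/-- The functionals that are the coordinates in the canonical basis of the abelian ideal. -/
noncomputable def colDual : ColIndex T → Module.Dual K (R.Ide K)
  | inl ⟨t, i, k⟩ => R.func (fun r => R.jordanH t i k r * a (R.hVec K r))
      fun c => R.jordanSeries x a t i k c * chainSeries R.base R.ν a c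
  | inr ⟨j, i⟩ => R.func (fun r => R.kronH x a β j i r * x (R.hVec K r))
      fun c => R.kronSeries x a β j i c * chainSeries R.base R.ν x c

/-- The canonical basis of the acting algebra. -/
noncomputable def rowVec : RowIndex T → R.Act K
  | inl ⟨t, i, k⟩ => actElem R.ν (R.jordanG t i k) (R.jordanSeries x a t i k)
  | inr ⟨j, i⟩ => actElem R.ν (R.kronG x a β j i) (R.kronSeries x a β j i)

/-- The defining property of the weights of the Kronecker families. -/
def IsWeight : Prop := ∀ j : Fin T.q, (∀ r, β j r ≠ 0) ∧ ∀ i < T.k j - 1, ∀ r : Fin (T.k j),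
  ∑ l : Fin (T.k j - 1), β j ⟨l + 1, by omega⟩ *
      (a (R.hVec K (inr ⟨j, ⟨l + 1, by omega⟩⟩)) / x (R.hVec K (inr ⟨j, ⟨l + 1, by omega⟩⟩))) ^ i *
        (if (r : ℕ) = 0 ∨ (r : ℕ) = l + 1 then 1 else 0) =
      β j r * (a (R.hVec K (inr ⟨j, r⟩)) / x (R.hVec K (inr ⟨j, r⟩))) ^ i

variable {x a}

theorem div_injective (h : R.Generic x a) :
    Function.Injective fun r => a (R.hVec K r) / x (R.hVec K r) := by
  intro r r' hr
  by_contra hne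
  apply h.ne r r' hne
  have h1 := h.x_ne r
  have h2 := h.x_ne r'
  simp only at hr
  field_simp at hr
  linear_combination -hr

theorem eigen_injective (h : R.Generic x a) : Function.Injective (R.eigen x a) := by
  intro r r' hr
  by_contra hne
  apply h.ne r r' hne
  have h1 := h.a_ne r
  have h2 := h.a_ne r'
  simp only [eigen] at hr
  field_simp at hr
  linear_combination hr

theorem exists_isWeight (h : R.Generic x a) : ∃ β, R.IsWeight x a β := by
  have := fun j => exists_weights (T.k j)
    (fun r => a (R.hVec K (inr ⟨j, r⟩)) / x (R.hVec K (inr ⟨j, r⟩)))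
    fun r r' hr => by simpa using R.div_injective h hr
  choose β hβ using this
  exact ⟨β, hβ⟩

variable {β}

theorem a_comp_rowVec_inl (t : Fin T.p) (i : Fin (T.J t).s) (k : Fin ((T.J t).n i)) :
    a ∘ₗ R.act (R.rowVec x a β (inl ⟨t, i, k⟩)) = R.colDual x a β (inl ⟨t, i, k⟩) :=
  R.apply_act_actElem a _ _ _ (R.sum_jordanG t i k) (R.coeff_zero_jordanSeries x a t i k)

theorem x_comp_rowVec_inl (h : R.Generic x a) (t : Fin T.p) (i : Fin (T.J t).s)
    (k : Fin ((T.J t).n i)) :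
    x ∘ₗ R.act (R.rowVec x a β (inl ⟨t, i, k⟩)) =
      R.eigen x a (R.κ t) • R.colDual x a β (inl ⟨t, i, k⟩) +
        if h : (k : ℕ) + 1 < (T.J t).n i then R.colDual x a β (inl ⟨t, i, ⟨k + 1, h⟩⟩) else 0 := by
  have h1 := R.apply_act_actElem x _ _ _ (R.sum_jordanG (K := K) t i k)
    (R.coeff_zero_jordanSeries x a t i k)
  -- The default 0 after the last column is correct because the next member of the family vanishes
  -- on the whole ideal.
  have hlast : (if h : (k : ℕ) + 1 < (T.J t).n i then
      R.colDual x a β (inl ⟨t, i, ⟨k + 1, h⟩⟩) else 0) =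
      R.func (fun r => R.jordanH t i (k + 1) r * a (R.hVec K r))
        fun c => R.jordanSeries x a t i (k + 1) c * chainSeries R.base R.ν a c := by
    split_ifs with hk
    · rfl
    · obtain hk : (k : ℕ) + 1 = (T.J t).n i := by omega
      refine R.dual_ext (fun r => ?_) fun c j => ?_
      · rw [func_h]
        simp [jordanH]
      · rw [func_e, hk, R.jordanSeries_mul_eq_zero x a t i c _ _ j.isLt]
        rfl
  rw [rowVec, h1, hlast, colDual]
  refine R.dual_ext (fun r => ?_) fun c j => ?_
  · simp only [LinearMap.add_apply, LinearMap.smul_apply, func_h, smul_eq_mul]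
    exact R.jordanH_mul x a h.a_ne t i k r
  · simp only [LinearMap.add_apply, LinearMap.smul_apply, func_e, smul_eq_mul]
    rw [R.jordanSeries_mul x a h.a_ne, map_add, coeff_C_mul]

theorem x_comp_rowVec_inr (hβ : R.IsWeight x a β) (j : Fin T.q) (i : Fin (T.k j - 1)) :
    x ∘ₗ R.act (R.rowVec x a β (inr ⟨j, i⟩)) = R.colDual x a β (inr ⟨j, ⟨i, by omega⟩⟩) :=
  R.apply_act_actElem x _ _ _ (R.sum_kronG x a β j i ((hβ j).2 i i.isLt))
    (R.coeff_zero_kronSeries x a β j i)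

/-- For the last i, the column i + 1 has no row vector of its own; `colDual` is therefore defined by
its series and not through `rowVec`. -/
theorem a_comp_rowVec_inr (h : R.Generic x a) (hβ : R.IsWeight x a β) (j : Fin T.q)
    (i : Fin (T.k j - 1)) :
    a ∘ₗ R.act (R.rowVec x a β (inr ⟨j, i⟩)) = R.colDual x a β (inr ⟨j, ⟨i + 1, by omega⟩⟩) := by
  refine (R.apply_act_actElem a _ _ _ (R.sum_kronG x a β j i ((hβ j).2 i i.isLt))
    (R.coeff_zero_kronSeries x a β j i)).trans ?_
  simp only [colDual, R.kronSeries_mul x a β h.x_ne, R.kronH_mul x a β h.x_ne]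

theorem colDual_inl_chainVec (t : Fin T.p) (i : Fin (T.J t).s) (k : Fin ((T.J t).n i)) (c : R.I)
    (p : ℕ) (hp : p ≤ R.ν c) : R.colDual x a β (inl ⟨t, i, k⟩) (chainVec K R.base R.ν c p) =
      coeff p (R.jordanSeries x a t i k c * chainSeries R.base R.ν a c) := by
  rw [← R.a_comp_rowVec_inl]
  exact apply_chainAct_actElem_chainVec _ _ _ _ _ _ _
    (by rw [coeff_zero_jordanSeries, sum_jordanG]) _ hp

/-- A vanishing combination of the coordinate functionals, evaluated on a vector at which only one
block of them is nonzero. -/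
theorem sum_block {ι κ' : Type} [Fintype ι] [Fintype κ'] {W : Type u} [AddCommGroup W] [Module K W]
    {d : κ' → Module.Dual K W} {α : κ' → K} (hα : ∑ z, α z • d z = 0) (m : W) (e : ι → κ')
    (he : Function.Injective e) (h : ∀ z ∉ Set.range e, α z * d z m = 0) :
    ∑ k, α (e k) * d (e k) m = 0 := by
  rw [Fintype.sum_of_injective e he (fun k => α (e k) * d (e k) m) (fun z => α z * d z m) h
    fun _ => rfl]
  simpa using LinearMap.congr_fun hα m

theorem linearIndependent_colDual (h : R.Generic x a) (hβ : R.IsWeight x a β) :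
    LinearIndependent K (R.colDual x a β) := by
  rw [Fintype.linearIndependent_iff]
  intro α hα
  have hnil : ∀ c, coeff 0 (R.nil x a c) = 0 := fun c => coeff_zero_nilQuot _ _
  have hcs : ∀ c, coeff 0 (chainSeries R.base R.ν a c) ≠ 0 := fun c => by
    rw [coeff_zero_chainSeries]; exact h.a_ne _
  -- On the h of block j only the Kronecker family j survives, with values β r * x(h_r) * μ r ^ i: a
  -- Vandermonde system with distinct nodes.
  have hK : ∀ j i, α (inr ⟨j, i⟩) = 0 := by
    intro j
    have hz : (fun i => α (inr ⟨j, i⟩)) = 0 := by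
      refine Matrix.eq_zero_of_forall_index_sum_mul_pow_eq_zero
        (f := fun r => a (R.hVec K (inr ⟨j, r⟩)) / x (R.hVec K (inr ⟨j, r⟩)))
        (fun r r' hr => by simpa using R.div_injective h hr) fun r => ?_
      have hs := sum_block hα (R.hVec K (inr ⟨j, r⟩)) (fun i => inr ⟨j, i⟩)
        (fun i i' hi => by simpa using hi) (by
          rintro (⟨t, i, k⟩ | ⟨j', i⟩) hz
          · rw [colDual, func_h, jordanH, if_neg, zero_mul, mul_zero]
            rintro ⟨ht, -, -, hr⟩
            have hκ : R.κ t = inl ⟨t, ht⟩ := R.κ_of_mem ⟨t, ht⟩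
            rw [hκ] at hr
            cases hr
          · rcases eq_or_ne j j' with rfl | hj
            · exact absurd ⟨i, rfl⟩ hz
            · simp [colDual, func_h, kronH, kronWeight, hj])
      have hne : β j r * x (R.hVec K (inr ⟨j, r⟩)) ≠ 0 := mul_ne_zero ((hβ j).1 r) (h.x_ne _)
      refine (mul_eq_zero.mp ?_).resolve_left hne
      rw [← hs, Finset.mul_sum]
      refine Finset.sum_congr rfl fun i _ => ?_
      rw [colDual, func_h, kronH, kronWeight, if_pos rfl]
      ring
    exact fun i => congrFun hz i
  -- On the first chain of t only the powers w ^ k of block 0 remain, and w ^ k has no terms below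
  -- degree k.
  have hF : ∀ t ∈ R.F, ∀ k, α (inl ⟨t, ⟨0, (T.J t).s_pos⟩, k⟩) = 0 := by
    intro t ht
    have hn := R.ν_add t ⟨0, (T.J t).s_pos⟩
    rw [if_pos ⟨ht, rfl⟩] at hn
    have hz : (fun k => α (inl ⟨t, ⟨0, (T.J t).s_pos⟩, k⟩)) = 0 := by
      let c : R.I := ⟨t, ⟨0, (T.J t).s_pos⟩⟩
      have hc : R.ν c + 1 = _ := hn
      refine eq_zero_of_triangular
        (fun k p => coeff p (R.nil x a c ^ k * chainSeries R.base R.ν a c)) _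
        (fun k p hp => coeff_pow_mul_of_lt (hnil c) _ hp) (fun k hk => ?_) fun p hp => ?_
      · rw [coeff_pow_mul_self (hnil c)]
        refine mul_ne_zero ?_ (hcs c)
        rcases Nat.eq_zero_or_pos k with rfl | hk'
        · simp
        · exact pow_ne_zero _ (R.coeff_one_nil x a h c (by omega))
      · have hs := sum_block hα (chainVec K R.base R.ν c p)
          (fun k => inl ⟨t, ⟨0, (T.J t).s_pos⟩, k⟩) (fun k k' hk => by simpa using hk) (by
            rintro (⟨t', i', k⟩ | ⟨j', i⟩) hz
            · rw [R.colDual_inl_chainVec _ _ _ _ _ (by omega), jordanSeries]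
              split_ifs with h1 h2 h2
              · obtain rfl : t = t' := h2
                obtain rfl : i' = ⟨0, (T.J t).s_pos⟩ := Fin.ext h1.2
                exact absurd ⟨k, rfl⟩ hz
              · simp
              · obtain rfl : t = t' := congrArg Sigma.fst h2
                obtain rfl : ⟨0, (T.J t).s_pos⟩ = i' := by simpa [c] using h2
                exact absurd ⟨ht, rfl⟩ h1
              · simp
            · rw [hK, zero_mul])
        rw [← hs]
        refine Finset.sum_congr rfl fun k _ => ?_
        rw [R.colDual_inl_chainVec _ _ _ _ _ (by omega), jordanSeries, if_pos ⟨ht, rfl⟩,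
          if_pos rfl]
    exact fun k => congrFun hz k
  -- The remaining blocks live on their own chain and start at w ^ 1, so degrees are shifted by one
  -- and the base h is skipped.
  have hJ : ∀ t (i : Fin (T.J t).s), ¬ (t ∈ R.F ∧ (i : ℕ) = 0) → ∀ k, α (inl ⟨t, i, k⟩) = 0 := by
    intro t i hti
    have hn := R.ν_add t i
    rw [if_neg hti] at hn
    have hz : (fun k => α (inl ⟨t, i, k⟩)) = 0 := by
      let c : R.I := ⟨t, i⟩
      have hc : R.ν c = _ := hn
      refine eq_zero_of_triangular
        (fun k p => coeff (p + 1) (R.nil x a c ^ (k + 1) * chainSeries R.base R.ν a c)) _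
        (fun k p hp => coeff_pow_mul_of_lt (hnil c) _ (by omega)) (fun k hk => ?_) fun p hp => ?_
      · rw [coeff_pow_mul_self (hnil c)]
        exact mul_ne_zero (pow_ne_zero _ (R.coeff_one_nil x a h c (by omega))) (hcs c)
      · have hs := sum_block hα (chainVec K R.base R.ν c (p + 1))
          (fun k => inl ⟨t, i, k⟩) (fun k k' hk => by simpa using hk) (by
            rintro (⟨t', i', k⟩ | ⟨j', i⟩) hz
            · by_cases h1 : t' ∈ R.F ∧ (i' : ℕ) = 0
              · obtain rfl : i' = ⟨0, (T.J t').s_pos⟩ := Fin.ext h1.2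
                rw [hF t' h1.1, zero_mul]
              · rw [R.colDual_inl_chainVec _ _ _ _ _ (by omega), jordanSeries, if_neg h1]
                split_ifs with h2
                · obtain rfl : t = t' := congrArg Sigma.fst h2
                  obtain rfl : i = i' := by simpa [c] using h2
                  exact absurd ⟨k, rfl⟩ hz
                · simp
            · rw [hK, zero_mul])
        rw [← hs]
        refine Finset.sum_congr rfl fun k _ => ?_
        rw [R.colDual_inl_chainVec _ _ _ _ _ (by omega), jordanSeries, if_neg hti, if_pos rfl]
    exact fun k => congrFun hz k
  rintro (⟨t, i, k⟩ | ⟨j, i⟩)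
  · by_cases hti : t ∈ R.F ∧ (i : ℕ) = 0
    · obtain rfl : i = ⟨0, (T.J t).s_pos⟩ := Fin.ext hti.2
      exact hF t hti.1 k
    · exact hJ t i hti k
  · exact hK j i

/-- Composition with `a` sends Jordan rows to their own columns and Kronecker rows to the next ones,
hence the rows injectively into an independent family. -/
theorem exists_rowBasis (h : R.Generic x a) (hβ : R.IsWeight x a β) :
    ∃ b : Module.Basis (RowIndex T) K (R.Act K), ⇑b = R.rowVec x a β := by
  let e : RowIndex T → ColIndex T
    | inl z => inl z
    | inr ⟨j, i⟩ => inr ⟨j, ⟨i + 1, by omega⟩⟩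
  have he : Function.Injective e := by
    rintro (⟨t, i, k⟩ | ⟨j, i⟩) (⟨t', i', k'⟩ | ⟨j', i'⟩) hz
    · simpa [e] using hz
    · simp [e] at hz
    · simp [e] at hz
    · simp only [e, inr.injEq, Sigma.mk.injEq] at hz
      obtain ⟨rfl, hz⟩ := hz
      simp only [heq_eq_eq, Fin.mk.injEq, Nat.add_right_cancel_iff] at hz
      rw [Fin.ext hz]
  let Ψ : R.Act K →ₗ[K] Module.Dual K (R.Ide K) :=
    (LinearMap.llcomp K (R.Ide K) (R.Ide K) K a) ∘ₗ R.act
  have hli : LinearIndependent K (R.rowVec x a β) := by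
    refine LinearIndependent.of_comp Ψ ?_
    have : ⇑Ψ ∘ R.rowVec x a β = R.colDual x a β ∘ e := by
      funext z
      rcases z with ⟨t, i, k⟩ | ⟨j, i⟩
      · exact R.a_comp_rowVec_inl t i k
      · exact R.a_comp_rowVec_inr h hβ j i
    rw [this]
    exact (R.linearIndependent_colDual h hβ).comp e he
  exact ⟨basisOfLinearIndependentOfCardEqFinrank' _ hli
    (by rw [R.card_rowIndex, Module.finrank_fintype_fun_eq_card]), by simp⟩

end Realization

end JordanKronecker

namespace JordanKronecker

open Sum PowerSeries

/-! ### The algebraic type of a generic pencil. -/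

namespace Realization

variable {T : AlgebraicType} (R : Realization T) {K : Type u} [Field K]

theorem finrank_Ide : Fintype.card (ColIndex T) = Module.finrank K (R.Ide K) :=
  R.card_colIndex.trans (Module.finrank_fintype_fun_eq_card K).symm

theorem exists_colBasis {x a : Module.Dual K (R.Ide K)} {β : ∀ j : Fin T.q, Fin (T.k j) → K}
    (h : R.Generic x a) (hβ : R.IsWeight x a β) :
    ∃ b : Module.Basis (ColIndex T) K (R.Ide K), ∀ i j, (i = j → R.colDual x a β i (b j) = 1) ∧
      (i ≠ j → R.colDual x a β i (b j) = 0) := by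
  obtain ⟨b, hb⟩ := exists_basis_of_linearIndependent_dual (R.colDual x a β)
    (R.linearIndependent_colDual h hβ) R.finrank_Ide
  exact ⟨b, fun i j => ⟨fun hij => (hb i j).trans (if_pos hij),
    fun hij => (hb i j).trans (if_neg hij)⟩⟩

open Classical in
theorem exists_bases (x a : Module.Dual K (R.Ide K)) (h : R.Generic x a) :
    ∃ (bU : Module.Basis (RowIndex T) K (R.Act K)) (bW : Module.Basis (ColIndex T) K (R.Ide K)),
      (∀ z y, (x ∘ₗ R.act (bU z)) (bW y) = offDiagA T (fun t => R.eigen x a (R.κ t)) z y) ∧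
      (∀ z y, (a ∘ₗ R.act (bU z)) (bW y) = offDiagB T z y) := by
  obtain ⟨β, hβ⟩ := R.exists_isWeight h
  obtain ⟨bU, hU⟩ := R.exists_rowBasis h hβ
  obtain ⟨bW, hW⟩ := R.exists_colBasis h hβ
  have hW' : ∀ i j (c : K), c * R.colDual x a β i (bW j) = if j = i then c else 0 := by
    intro i j c
    split_ifs with hij
    · rw [(hW i j).1 hij.symm, mul_one]
    · rw [(hW i j).2 (Ne.symm hij), mul_zero]
  have hW1 : ∀ i j, R.colDual x a β i (bW j) = if j = i then 1 else 0 := fun i j => by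
    rw [← hW', one_mul]
  refine ⟨bU, bW, ?_, ?_⟩
  · rintro (⟨t, i, k⟩ | ⟨j, i⟩) y
    · rw [hU, R.x_comp_rowVec_inl h, LinearMap.add_apply, LinearMap.smul_apply, smul_eq_mul, hW',
        offDiagA]
      congr 1
      by_cases hk : (k : ℕ) + 1 < (T.J t).n i
      · rw [dif_pos hk, dif_pos hk, hW1]
      · rw [dif_neg hk, dif_neg hk]; rfl
    · rw [hU, R.x_comp_rowVec_inr hβ, hW1]; rfl
  · rintro (⟨t, i, k⟩ | ⟨j, i⟩) y
    · rw [hU, R.a_comp_rowVec_inl, hW1]; rfl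
    · rw [hU, R.a_comp_rowVec_inr h hβ, hW1]; rfl

/-- The Lie algebra that realizes the type `T`. -/
abbrev lieAlg (K : Type u) [Field K] : Type u :=
  AbelianSemidirect (R.act (K := K)) (chainAct_commute (R.weight K) R.base R.ν)

theorem hasAlgebraicType (x a : Module.Dual K (R.lieAlg K))
    (h : R.Generic (AbelianSemidirect.restrict _ _ x) (AbelianSemidirect.restrict _ _ a)) :
    HasAlgebraicType K (lieForm K x) (lieForm K a) T := by
  obtain ⟨bU, bW, hx, ha⟩ := R.exists_bases _ _ h
  exact AbelianSemidirect.hasAlgebraicType _ _ T _ ((R.eigen_injective h).comp R.κ_injective)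
    x a bU bW hx ha

end Realization

end JordanKronecker

namespace JordanKronecker

open Sum

namespace AbelianSemidirect

variable {K : Type u} [Field K] {U W : Type u} [AddCommGroup U] [Module K U]
  [AddCommGroup W] [Module K W] (ρ : U →ₗ[K] Module.End K W) (hρ : ∀ a b, Commute (ρ a) (ρ b))

theorem restrict_apply (x : Module.Dual K (AbelianSemidirect ρ hρ)) (w : W) :
    restrict ρ hρ x w = x ((equivProd ρ hρ).symm (0, w)) := rfl

theorem exists_restrict_eq (y : Module.Dual K W) :
    ∃ x : Module.Dual K (AbelianSemidirect ρ hρ), restrict ρ hρ x = y :=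
  ⟨y ∘ₗ LinearMap.snd K U W ∘ₗ (equivProd ρ hρ).toLinearMap, by ext; simp [restrict_apply]⟩

theorem symm_lie_symm (u u' : U) (w w' : W) :
    ⁅(equivProd ρ hρ).symm (u, w), (equivProd ρ hρ).symm (u', w')⁆ =
      (equivProd ρ hρ).symm (0, ρ u w' - ρ u' w) := rfl

end AbelianSemidirect

/-! ### The generic set is nonempty and Zariski open. -/

namespace Realization

variable {T : AlgebraicType} (R : Realization T) {K : Type u} [Field K]

theorem exists_generic [CharZero K] : ∃ x a : Module.Dual K (R.Ide K), R.Generic x a := by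
  -- The values 1, 2, 3, … of x on the h are nonzero and distinct in characteristic zero; a is 1 on
  -- every h and 0 on every e. The series X gives the first e of each chain the value 1 under x, so
  -- the minors in `e_ne` equal 1.
  let s : R.H → K := fun r => ((Fintype.equivFin R.H r : ℕ) : K) + 1
  refine ⟨R.func s fun _ => PowerSeries.X, R.func (fun _ => 1) fun _ => 0, ?_, ?_, ?_, ?_⟩
  · intro r
    rw [func_h]
    exact Nat.cast_add_one_ne_zero _
  · intro r
    simp [func_h]
  · intro r r' h
    simp only [func_h, mul_one, s, ne_eq, add_left_inj, Nat.cast_inj]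
    exact fun h' => h ((Fintype.equivFin R.H).injective (Fin.ext h'))
  · intro c hc
    simp [func_h, func_e]

/-- The condition of genericity on a pair of functionals on the Lie algebra. -/
def genericSet (K : Type u) [Field K] :
    Set (Module.Dual K (R.lieAlg K) × Module.Dual K (R.lieAlg K)) :=
  {z | R.Generic (AbelianSemidirect.restrict _ _ z.1) (AbelianSemidirect.restrict _ _ z.2)}

theorem genericSet_nonempty [CharZero K] : (R.genericSet K).Nonempty := by
  obtain ⟨x, a, h⟩ := R.exists_generic (K := K)
  obtain ⟨x', hx⟩ := AbelianSemidirect.exists_restrict_eq _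
    (chainAct_commute (R.weight K) R.base R.ν) x
  obtain ⟨a', ha⟩ := AbelianSemidirect.exists_restrict_eq _
    (chainAct_commute (R.weight K) R.base R.ν) a
  refine ⟨(x', a'), ?_⟩
  rw [← hx, ← ha] at h
  exact h

/-- The value of the first functional at an element of the ideal, as a polynomial. -/
noncomputable def polyFst (w : R.Ide K) :
    MvPolynomial (Module.Dual K (Module.Dual K (R.lieAlg K) × Module.Dual K (R.lieAlg K))) K :=
  MvPolynomial.X (Module.Dual.eval K _ ((AbelianSemidirect.equivProd _ _).symm (0, w)) ∘ₗ
    LinearMap.fst K _ _)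

/-- The value of the second functional at an element of the ideal, as a polynomial. -/
noncomputable def polySnd (w : R.Ide K) :
    MvPolynomial (Module.Dual K (Module.Dual K (R.lieAlg K) × Module.Dual K (R.lieAlg K))) K :=
  MvPolynomial.X (Module.Dual.eval K _ ((AbelianSemidirect.equivProd _ _).symm (0, w)) ∘ₗ
    LinearMap.snd K _ _)

theorem eval_polyFst (w : R.Ide K) (z : Module.Dual K (R.lieAlg K) × Module.Dual K (R.lieAlg K)) :
    MvPolynomial.eval (fun φ : Module.Dual K _ => φ z) (R.polyFst w) =
      AbelianSemidirect.restrict _ _ z.1 w := by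
  rw [polyFst, MvPolynomial.eval_X]; rfl

theorem eval_polySnd (w : R.Ide K) (z : Module.Dual K (R.lieAlg K) × Module.Dual K (R.lieAlg K)) :
    MvPolynomial.eval (fun φ : Module.Dual K _ => φ z) (R.polySnd w) =
      AbelianSemidirect.restrict _ _ z.2 w := by
  rw [polySnd, MvPolynomial.eval_X]; rfl

/-- Genericity consists of finitely many polynomial inequations, so the product of these polynomials
defines the set. -/
theorem isZariskiOpen_genericSet : IsZariskiOpen K (R.genericSet K) := by
  refine ⟨{(∏ r, R.polyFst (R.hVec K r)) * (∏ r, R.polySnd (R.hVec K r)) *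
    (∏ r, ∏ r', if r = r' then 1 else R.polyFst (R.hVec K r) * R.polySnd (R.hVec K r') -
      R.polyFst (R.hVec K r') * R.polySnd (R.hVec K r)) *
    (∏ c, if h : 0 < R.ν c then
      R.polyFst (Pi.single (inr ⟨c, 0, h⟩) 1) * R.polySnd (R.hVec K (R.base c)) -
        R.polyFst (R.hVec K (R.base c)) * R.polySnd (Pi.single (inr ⟨c, 0, h⟩) 1) else 1)}, ?_⟩
  ext z
  simp only [Set.mem_ofPred_eq, Set.mem_singleton_iff, exists_eq_left, map_mul, map_prod,
    mul_ne_zero_iff, Finset.prod_ne_zero_iff, Finset.mem_univ, true_implies, apply_ite, apply_dite,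
    map_sub, map_one, eval_polyFst, eval_polySnd, genericSet]
  constructor
  · intro h
    refine ⟨⟨⟨h.x_ne, h.a_ne⟩, fun r r' => ?_⟩, fun c => ?_⟩
    · split_ifs with hr
      · exact one_ne_zero
      · exact sub_ne_zero.mpr (h.ne r r' hr)
    · split_ifs with hc
      · exact sub_ne_zero.mpr (h.e_ne c hc)
      · exact one_ne_zero
  · rintro ⟨⟨⟨h1, h2⟩, h3⟩, h4⟩
    refine ⟨h1, h2, fun r r' hr => ?_, fun c hc => ?_⟩
    · have := h3 r r'
      rw [if_neg hr] at this
      exact sub_ne_zero.mp this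
    · have := h4 c
      rw [dif_pos hc] at this
      exact sub_ne_zero.mp this

theorem hasJKInvariants [CharZero K] : HasJKInvariants K (R.lieAlg K) T :=
  ⟨R.genericSet K, R.genericSet_nonempty, R.isZariskiOpen_genericSet,
    fun z hz => R.hasAlgebraicType z.1 z.2 hz⟩

/-! ### Structure constants. -/

/-- The basis of the Lie algebra. -/
noncomputable def lieBasis (K : Type u) [Field K] :
    Module.Basis (ActLabel R.G R.ν ⊕ IdealLabel R.H R.ν) K (R.lieAlg K) :=
  ((Pi.basisFun K _).prod (Pi.basisFun K _)).map (AbelianSemidirect.equivProd _ _).symm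

theorem lieBasis_inl (v : ActLabel R.G R.ν) : R.lieBasis K (inl v) =
    (AbelianSemidirect.equivProd _ _).symm (Pi.single v 1, 0) := by
  simp [lieBasis]

theorem lieBasis_inr (v : IdealLabel R.H R.ν) : R.lieBasis K (inr v) =
    (AbelianSemidirect.equivProd _ _).symm (0, Pi.single v 1) := by
  simp [lieBasis]

theorem lie_inl_inl (v w : ActLabel R.G R.ν) :
    ⁅R.lieBasis K (inl v), R.lieBasis K (inl w)⁆ = 0 := by
  rw [lieBasis_inl, lieBasis_inl, AbelianSemidirect.symm_lie_symm]
  simp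

theorem lie_inr_inr (v w : IdealLabel R.H R.ν) :
    ⁅R.lieBasis K (inr v), R.lieBasis K (inr w)⁆ = 0 := by
  rw [lieBasis_inr, lieBasis_inr, AbelianSemidirect.symm_lie_symm]
  simp

theorem lie_inl_inr (v : ActLabel R.G R.ν) (w : IdealLabel R.H R.ν) :
    ⁅R.lieBasis K (inl v), R.lieBasis K (inr w)⁆ =
      (AbelianSemidirect.equivProd _ _).symm (0, basisAct (R.weight K) R.base R.ν v w) := by
  rw [lieBasis_inl, lieBasis_inr, AbelianSemidirect.symm_lie_symm, ← chainAct_single]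
  simp

theorem lie_inr_inl (v : ActLabel R.G R.ν) (w : IdealLabel R.H R.ν) :
    ⁅R.lieBasis K (inr w), R.lieBasis K (inl v)⁆ =
      (AbelianSemidirect.equivProd _ _).symm (0, - basisAct (R.weight K) R.base R.ν v w) := by
  rw [← lie_skew, lie_inl_inr, ← map_neg]
  simp

theorem lie_g_h (l : R.G) (r : R.H) : ⁅R.lieBasis K (inl (inl l)), R.lieBasis K (inr (inl r))⁆ =
    R.weight K l r • R.lieBasis K (inr (inl r)) := by
  rw [lie_inl_inr, lieBasis_inr, ← map_smul, Prod.smul_mk, smul_zero]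
  rfl

theorem lie_g_e (l : R.G) (c : R.I) (j : Fin (R.ν c)) :
    ⁅R.lieBasis K (inl (inl l)), R.lieBasis K (inr (inr ⟨c, j⟩))⁆ =
      R.weight K l (R.base c) • R.lieBasis K (inr (inr ⟨c, j⟩)) := by
  rw [lie_inl_inr, lieBasis_inr, ← map_smul, Prod.smul_mk, smul_zero]
  rfl

theorem lie_h_f (r : R.H) (c : R.I) (k : Fin (R.ν c)) :
    ⁅R.lieBasis K (inr (inl r)), R.lieBasis K (inl (inr ⟨c, k⟩))⁆ = 0 := by
  rw [lie_inr_inl, basisAct, neg_zero]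
  exact map_zero _

theorem lie_e_f_eq_zero (c c' : R.I) (j : Fin (R.ν c)) (k : Fin (R.ν c'))
    (h : ¬ (c' = c ∧ (k : ℕ) ≤ j)) :
    ⁅R.lieBasis K (inr (inr ⟨c, j⟩)), R.lieBasis K (inl (inr ⟨c', k⟩))⁆ = 0 := by
  rw [lie_inr_inl, basisAct, if_neg h, neg_zero]
  exact map_zero _

theorem lie_e_f_of_le (c : R.I) (j k : Fin (R.ν c)) (h : k ≤ j) :
    ⁅R.lieBasis K (inr (inr ⟨c, j⟩)), R.lieBasis K (inl (inr ⟨c, k⟩))⁆ =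
      (AbelianSemidirect.equivProd _ _).symm (0, chainVec K R.base R.ν c (j - k)) := by
  rw [lie_inr_inl, basisAct, if_pos ⟨rfl, h⟩, neg_neg]

theorem lie_e_f_self (c : R.I) (j : Fin (R.ν c)) :
    ⁅R.lieBasis K (inr (inr ⟨c, j⟩)), R.lieBasis K (inl (inr ⟨c, j⟩))⁆ =
      R.lieBasis K (inr (inl (R.base c))) := by
  rw [lie_e_f_of_le _ _ _ _ le_rfl, Nat.sub_self, lieBasis_inr]
  rfl

theorem lie_e_f_of_lt (c : R.I) (j k : Fin (R.ν c)) (h : k < j) :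
    ⁅R.lieBasis K (inr (inr ⟨c, j⟩)), R.lieBasis K (inl (inr ⟨c, k⟩))⁆ =
      R.lieBasis K (inr (inr ⟨c, ⟨(j : ℕ) - k - 1, by omega⟩⟩)) := by
  rw [lie_e_f_of_le _ _ _ _ h.le, lieBasis_inr, ← chainVec_succ R.base]
  congr 3
  have : (k : ℕ) < j := h
  change _ = (j : ℕ) - k - 1 + 1
  omega

theorem smul_eq_ite {V : Type u} [AddCommGroup V] [Module K V] {p : Prop} [Decidable p] {c : K}
    (hc : c = if p then 1 else 0) (v : V) : c • v = if p then v else 0 := by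
  rw [hc, ite_smul, one_smul, zero_smul]

/-! ### The two ways of attaching tuples. -/

/-- The realization with a single Kronecker block, to which all tuples are attached. -/
def single {m d : ℕ} (hd : d ≤ m + 1) (J : Fin d → JordanTuple) :
    Realization ⟨d, J, 1, fun _ => m + 1, fun _ => Nat.succ_pos m⟩ where
  F := ∅
  κ t := inr ⟨0, Fin.castLE hd t⟩
  κ_injective t t' h := by simpa using h
  κ_of_mem t := absurd t.2 (Finset.notMem_empty _)
  ν c := (J c.1).n c.2
  ν_add t i := by simp
  ν_le t h := absurd h (Finset.notMem_empty _)

/-- The labels of the basis of the realization with a single Kronecker block. -/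
def singleLabel {m d : ℕ} (hd : d ≤ m + 1) (J : Fin d → JordanTuple) :
    ActLabel (single hd J).G (single hd J).ν ⊕ IdealLabel (single hd J).H (single hd J).ν ≃
      BasisLabel m d J where
  toFun
    | inl (inl (inl t)) => absurd t.2 (Finset.notMem_empty _)
    | inl (inl (inr ⟨_, l⟩)) => .g l
    | inl (inr ⟨⟨t, i⟩, j⟩) => .f t i j
    | inr (inl (inl t)) => absurd t.2 (Finset.notMem_empty _)
    | inr (inl (inr ⟨_, r⟩)) => .h r
    | inr (inr ⟨⟨t, i⟩, j⟩) => .e t i j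
  invFun
    | .g l => inl (inl (inr ⟨0, l⟩))
    | .h r => inr (inl (inr ⟨0, r⟩))
    | .e t i j => inr (inr ⟨⟨t, i⟩, j⟩)
    | .f t i j => inl (inr ⟨⟨t, i⟩, j⟩)
  left_inv := by
    rintro (((⟨t, h⟩ | ⟨q, l⟩) | ⟨⟨t, i⟩, j⟩) | ((⟨t, h⟩ | ⟨q, l⟩) | ⟨⟨t, i⟩, j⟩))
    · exact absurd h (Finset.notMem_empty _)
    · obtain rfl : q = 0 := Subsingleton.elim _ _
      rfl
    · rfl
    · exact absurd h (Finset.notMem_empty _)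
    · obtain rfl : q = 0 := Subsingleton.elim _ _
      rfl
    · rfl
  right_inv := by rintro (l | r | ⟨t, i, j⟩ | ⟨t, i, j⟩) <;> rfl

/-- The basis of the realization with a single Kronecker block. -/
noncomputable def singleBasis (K : Type u) [Field K] {m d : ℕ} (hd : d ≤ m + 1)
    (J : Fin d → JordanTuple) : Module.Basis (BasisLabel m d J) K ((single hd J).lieAlg K) :=
  ((single hd J).lieBasis K).reindex (singleLabel hd J)

section

variable {m d : ℕ} (hd : d ≤ m + 1) (J : Fin d → JordanTuple)

theorem singleBasis_g (l : Fin m) : singleBasis K hd J (.g l) =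
    (single hd J).lieBasis K (inl (inl (inr ⟨0, l⟩))) :=
  Module.Basis.reindex_apply _ _ _

theorem singleBasis_h (r : Fin (m + 1)) : singleBasis K hd J (.h r) =
    (single hd J).lieBasis K (inr (inl (inr ⟨0, r⟩))) :=
  Module.Basis.reindex_apply _ _ _

theorem singleBasis_e (t : Fin d) (i : Fin (J t).s) (j : Fin ((J t).n i)) :
    singleBasis K hd J (.e t i j) = (single hd J).lieBasis K (inr (inr ⟨⟨t, i⟩, j⟩)) :=
  Module.Basis.reindex_apply _ _ _

theorem singleBasis_f (t : Fin d) (i : Fin (J t).s) (j : Fin ((J t).n i)) :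
    singleBasis K hd J (.f t i j) = (single hd J).lieBasis K (inl (inr ⟨⟨t, i⟩, j⟩)) :=
  Module.Basis.reindex_apply _ _ _

theorem commutationRelations_single :
    CommutationRelations hd J fun v => singleBasis K hd J v where
  gg l l' := by simp only [singleBasis_g]; exact (single hd J).lie_inl_inl _ _
  gf l t i k := by simp only [singleBasis_g, singleBasis_f]; exact (single hd J).lie_inl_inl _ _
  ff t i j t' i' k := by simp only [singleBasis_f]; exact (single hd J).lie_inl_inl _ _
  hh r r' := by simp only [singleBasis_h]; exact (single hd J).lie_inr_inr _ _
  he r t i k := by simp only [singleBasis_h, singleBasis_e]; exact (single hd J).lie_inr_inr _ _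
  ee t i j t' i' k := by simp only [singleBasis_e]; exact (single hd J).lie_inr_inr _ _
  hf r t i k := by
    simp only [singleBasis_h, singleBasis_f]
    exact (single hd J).lie_h_f _ _ _
  gh l r := by
    simp only [singleBasis_g, singleBasis_h]
    refine ((single hd J).lie_g_h _ _).trans (smul_eq_ite ?_ _)
    simp [weight]
  ge l t i k := by
    simp only [singleBasis_g, singleBasis_e]
    refine ((single hd J).lie_g_e _ _ _).trans (smul_eq_ite ?_ _)
    simp [weight, single]
  ef_gt t i j k h := by
    simp only [singleBasis_e, singleBasis_f]
    exact (single hd J).lie_e_f_of_lt ⟨t, i⟩ j k h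
  ef_eq t i j := by
    simp only [singleBasis_e, singleBasis_f, singleBasis_h]
    exact (single hd J).lie_e_f_self ⟨t, i⟩ j
  ef_lt t i j k h := by
    simp only [singleBasis_e, singleBasis_f]
    exact (single hd J).lie_e_f_eq_zero ⟨t, i⟩ ⟨t, i⟩ j k fun h' => absurd h'.2 (not_le.mpr h)
  ef_ne t i j t' i' k h := by
    simp only [singleBasis_e, singleBasis_f]
    exact (single hd J).lie_e_f_eq_zero ⟨t, i⟩ ⟨t', i'⟩ j k fun h' => h h'.1.symm

end

-- By counting, tuples with multiple maxima get distinct positions in the Kronecker blocks. All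
-- others go to `F`, where the strict maximum leaves room to shorten the first chain by one.
open Classical in
theorem nonempty_of_card_le (T : AlgebraicType)
    (hT : Nat.card {t : Fin T.p // (T.J t).HasMultipleMaxima} ≤ ∑ j, T.k j) :
    Nonempty (Realization T) := by
  rw [Nat.card_eq_fintype_card] at hT
  obtain ⟨τ⟩ : Nonempty ({t : Fin T.p // (T.J t).HasMultipleMaxima} ↪ Σ j, Fin (T.k j)) :=
    Function.Embedding.nonempty_of_card_le (by simpa using hT)
  let F : Finset (Fin T.p) := Finset.univ.filter fun t => ¬ (T.J t).HasMultipleMaxima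
  have hF : ∀ t, t ∈ F ↔ ¬ (T.J t).HasMultipleMaxima := fun t => by simp [F]
  refine ⟨{
    F := F
    κ := fun t => if h : t ∈ F then inl ⟨t, h⟩ else inr (τ ⟨t, not_not.mp fun h' => h ((hF t).2 h')⟩)
    κ_injective := ?_
    κ_of_mem := fun t => dif_pos t.2
    ν := fun c => (T.J c.1).n c.2 - if c.1 ∈ F ∧ (c.2 : ℕ) = 0 then 1 else 0
    ν_add := ?_
    ν_le := ?_ }⟩
  · intro t t' h
    simp only at h
    split_ifs at h
    · simpa using h
    · simpa using h
  · intro t i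
    have := (T.J t).n_pos i
    simp only
    split_ifs <;> omega
  · intro t ht i
    simp only [ht, true_and]
    rcases Nat.eq_zero_or_pos (i : ℕ) with hi | hi
    · obtain rfl : i = ⟨0, (T.J t).s_pos⟩ := Fin.ext hi
      exact le_rfl
    · have h1 : 1 < (T.J t).s := by omega
      have h2 : (T.J t).n i ≤ (T.J t).n ⟨1, h1⟩ := (T.J t).n_anti (Fin.le_def.mpr hi)
      have h3 : (T.J t).n ⟨1, h1⟩ ≤ (T.J t).n ⟨0, (T.J t).s_pos⟩ :=
        (T.J t).n_anti (Fin.le_def.mpr (Nat.zero_le _))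
      have h4 : (T.J t).n ⟨0, (T.J t).s_pos⟩ ≠ (T.J t).n ⟨1, h1⟩ := fun h => (hF t).1 ht ⟨h1, h⟩
      rw [if_neg (by omega), if_pos trivial]
      omega

end Realization

end JordanKronecker

theorem mainTheorem5 (K : Type u) [Field K] [IsAlgClosed K] [CharZero K] :
    (∀ (m d : ℕ) (hd : d ≤ m + 1) (J : Fin d → JordanKronecker.JordanTuple),
      ∃ (L : Type u) (_ : LieRing L) (_ : LieAlgebra K L)
        (b : Module.Basis (JordanKronecker.BasisLabel m d J) K L),
        JordanKronecker.CommutationRelations hd J (fun v => b v) ∧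
        LieAlgebra.IsSolvable L ∧
        JordanKronecker.HasJKInvariants K L
          { p := d, J := J, q := 1, k := fun _ => m + 1, k_pos := fun _ => Nat.succ_pos m }) ∧
    (∀ T : JordanKronecker.AlgebraicType,
      Nat.card {t : Fin T.p // (T.J t).HasMultipleMaxima} ≤ ∑ j, T.k j →
      ∃ (L : Type u) (_ : LieRing L) (_ : LieAlgebra K L),
        Module.Finite K L ∧ JordanKronecker.HasJKInvariants K L T) := by
  refine ⟨fun m d hd J => ?_, fun T hT => ?_⟩
  · exact ⟨_, inferInstance, inferInstance, JordanKronecker.Realization.singleBasis K hd J,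
      JordanKronecker.Realization.commutationRelations_single hd J, inferInstance,
      (JordanKronecker.Realization.single hd J).hasJKInvariants⟩
  · obtain ⟨R⟩ := JordanKronecker.Realization.nonempty_of_card_le T hT
    exact ⟨R.lieAlg K, inferInstance, inferInstance, Module.Finite.of_basis (R.lieBasis K),
      R.hasJKInvariants⟩
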